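/- Let $L$ be a finite nonempty relational language in which every relation symbol $E$ has arity at least $2$, and let $\overline\alpha:L\to(0,1)\cap\mathbb{Q}$. Let $c$ be the least common multiple of the denominators of the numbers $\overline\alpha(E)$, $E\in L$, written in reduced form. Let $K_L$ be the class of finite $L$-structures (the empty one included) in which every $E\in L$ is symmetric and holds only of tuples without repetitions. For $\mathfrak A\in K_L$ put $\delta(\mathfrak A)=|A|-\sum_{E\in L}\overline\alpha(E)N_E(\mathfrak A)$, where $N_E(\mathfrak A)$ is the number of subsets of $A$ on which $E$ holds, and let $K_{\overline\alpha}$ be the class of those $\mathfrak A\in K_L$ with $\delta(\mathfrak A')\ge 0$ for all $\mathfrak A'\subseteq\mathfrak A$. Let $\overline{K_{\overline\alpha}}$ be the class of $L$-structures all of whose finite substructures are in $K_{\overline\alpha}$. For finite $\mathfrak A\subseteq\mathfrak B$ write $\mathfrak A\le\mathfrak B$ if $\delta(\mathfrak A)\le\delta(\mathfrak A')$ for all $\mathfrak A\subseteq\mathfrak A'\subseteq\mathfrak B$; for infinite $\mathfrak M$ and finite $\mathfrak A\subseteq \mathfrak M$ write $\mathfrak A\le\mathfrak M$ if $\mathfrak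 A\le\mathfrak B$ for every finite $\mathfrak B$ with $\mathfrak A\subseteq\mathfrak B\subseteq\mathfrak M$. An embedding of a finite structure is strong if its image is $\le$ the target. Let $S_{\overline\alpha}$ be the theory whose models are the $\mathfrak M\in\overline{K_{\overline\alpha}}$ such that for all $\mathfrak A\le\mathfrak B$ from $K_{\overline\alpha}$ every embedding $\mathfrak A\to\mathfrak M$ extends to an embedding $\mathfrak B\to\mathfrak M$; it is axiomatized by the sentences saying that no finite structure outside $K_{\overline\alpha}$ embeds and by the extension axioms for the pairs $\mathfrak A\le\mathfrak B$ from $K_{\overline\alpha}$. Let $\dim(\mathfrak M)=\max\{\delta(\mathfrak B)-\delta(\emptyset):\mathfrak B\text{ finite},\ \emptyset\le\mathfrak B\le\mathfrak M\}$, and $\dim(\mathfrak M)=\infty$ if there is no maximum. For an integer $k\ge0$ let $K_{k/c}=\{\mathfrak A\in K_{\overline\alpha}:\delta(\mathfrak A)=k/c\}$ with $\le$ inherited from $K_{\overline\alpha}$. A countable $\mathfrak M\in\overline{K_{\overline\alpha}}$ is a generic for $(K_{k/c},\le)$ if 1. $\mathfrak M$ is the union of a chain $\mathfrak A_0\le\mathfrak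 A_1\le\cdots$ with all $\mathfrak A_i\in K_{k/c}$, and every finite $\mathfrak A\subseteq\mathfrak M$ is contained in some $\mathfrak B\le\mathfrak M$ with $\mathfrak B\in K_{k/c}$; 2. for all $\mathfrak A\le\mathfrak B$ in $K_{k/c}$, every strong embedding $\mathfrak A\to\mathfrak M$ extends to a strong embedding $\mathfrak B\to\mathfrak M$. Theorem. For every integer $k\ge0$, the class $(K_{k/c},\le)$ is a Fraïssé class (it has joint embedding and amalgamation with respect to strong embeddings), and it has a generic, which is unique up to isomorphism. Every generic $\mathfrak M_{k/c}$ for $(K_{k/c},\le)$ satisfies $\mathfrak M_{k/c}\models S_{\overline\alpha}$ and $\dim(\mathfrak M_{k/c})=k/c$. -/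

import Mathlib

open FirstOrder FirstOrder.Language FirstOrder.Language.Structure

universe u v w w'

namespace BaldwinShi

variable {L : FirstOrder.Language.{u, v}}

/-- The number of distinct subsets of `A` on which the relation symbol `E` holds. -/
noncomputable def numEdges (E : Σ n, L.Relations n) (A : Type w) [L.Structure A] : ℕ :=
  {s : Set A | ∃ x : Fin E.1 → A, RelMap E.2 x ∧ Set.range x = s}.ncard

/-- The rank of a finite structure: its size minus the weighted number of its edges. -/
noncomputable def delta [Fintype (Σ n, L.Relations n)] (α : (Σ n, L.Relations n) → ℚ)
    (A : Type w) [L.Structure A] : ℚ :=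
  (Nat.card A : ℚ) - ∑ E, α E * (numEdges E A : ℚ)

/-- Every relation symbol is interpreted irreflexively (only tuples without repetitions) and
symmetrically. This holds for a structure iff it holds for all its finite substructures. -/
def IsHypergraph (L : FirstOrder.Language.{u, v}) (M : Type w) [L.Structure M] : Prop :=
  ∀ (E : Σ n, L.Relations n) (x : Fin E.1 → M), RelMap E.2 x →
    Function.Injective x ∧ ∀ π : Equiv.Perm (Fin E.1), RelMap E.2 (x ∘ π)

section Rank

variable [Fintype (Σ n, L.Relations n)] (α : (Σ n, L.Relations n) → ℚ)

/-- The finite hypergraphs all of whose substructures have nonnegative rank. -/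
def InKAlpha (A : Type w) [L.Structure A] : Prop :=
  Finite A ∧ IsHypergraph L A ∧ ∀ A' : L.Substructure A, 0 ≤ delta α A'

/-- The structures (of any size) all of whose finite substructures lie in the class
`InKAlpha`. -/
def InKAlphaBar (M : Type w) [L.Structure M] : Prop :=
  ∀ A : L.Substructure M, Finite A → InKAlpha α A

/-- For substructures `A`, `B` of a common structure, with `B` finite: `A` is strong in `B`. -/
def StrongSub {M : Type w} [L.Structure M] (A B : L.Substructure M) : Prop :=
  A ≤ B ∧ ∀ A' : L.Substructure M, A ≤ A' → A' ≤ B → delta α A ≤ delta α A'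

/-- The finite substructure `A` is strong in the (possibly infinite) structure `M`: it is strong
in every finite substructure of `M` that contains it. -/
def StrongIn {M : Type w} [L.Structure M] (A : L.Substructure M) : Prop :=
  ∀ B : L.Substructure M, Finite B → A ≤ B → StrongSub α A B

/-- An embedding of a finite structure is strong if its image is strong in the target. -/
def IsStrongEmbedding {A : Type w} {M : Type w'} [L.Structure A] [L.Structure M]
    (f : A ↪[L] M) : Prop :=
  StrongIn α f.toHom.range

/-- The least common multiple of the denominators (in reduced form) of the weights. -/
def commonDenom : ℕ :=
  Finset.univ.lcm fun E => (α E).den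

/-- The class of those structures in `InKAlpha` that have rank exactly `k / c`. Its notion of
strong substructure is the one of `InKAlpha`. -/
def InKFix (k : ℕ) (A : Type w) [L.Structure A] : Prop :=
  InKAlpha α A ∧ delta α A = (k : ℚ) / (commonDenom α : ℚ)

/-- Joint embedding and amalgamation, with respect to strong embeddings, for the class of the
structures in `InKAlpha` of rank `k / c`. Every finite structure is isomorphic to one whose
universe lies in `Type`. -/
structure IsFraisseClassFix (k : ℕ) : Prop where
  jointEmbedding : ∀ (B C : Type) [L.Structure B] [L.Structure C], InKFix α k B → InKFix α k C →
    ∃ (D : Type) (_ : L.Structure D) (f : B ↪[L] D) (g : C ↪[L] D),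
      InKFix α k D ∧ IsStrongEmbedding α f ∧ IsStrongEmbedding α g
  amalgamation : ∀ (A B C : Type) [L.Structure A] [L.Structure B] [L.Structure C],
    InKFix α k A → InKFix α k B → InKFix α k C →
    ∀ (i : A ↪[L] B) (j : A ↪[L] C), IsStrongEmbedding α i → IsStrongEmbedding α j →
    ∃ (D : Type) (_ : L.Structure D) (f : B ↪[L] D) (g : C ↪[L] D),
      InKFix α k D ∧ IsStrongEmbedding α f ∧ IsStrongEmbedding α g ∧ f.comp i = g.comp j

/-- `M` is a generic structure for the class of the structures in `InKAlpha` of rank `k / c`. -/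
structure IsGenericFix (k : ℕ) (M : Type w) [L.Structure M] : Prop where
  countable : Countable M
  mem : InKAlphaBar α M
  /-- `M` is the union of an `ω`-chain of strong extensions within the class. -/
  chain : ∃ A : ℕ → L.Substructure M, (∀ i, InKFix α k (A i)) ∧
    (∀ i, StrongSub α (A i) (A (i + 1))) ∧ ∀ m : M, ∃ i, m ∈ A i
  /-- Every finite substructure lies in a strong substructure from the class. -/
  cofinal : ∀ A : L.Substructure M, Finite A →
    ∃ B : L.Substructure M, A ≤ B ∧ InKFix α k B ∧ StrongIn α B
  /-- If `A ≤ B` are in the class and `A ≤ M`, then some `B' ≤ M` is isomorphic to `B` over `A`. -/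
  rich : ∀ (A B : Type) [L.Structure A] [L.Structure B], InKFix α k A → InKFix α k B →
    ∀ (i : A ↪[L] B) (f : A ↪[L] M), IsStrongEmbedding α i → IsStrongEmbedding α f →
    ∃ g : B ↪[L] M, IsStrongEmbedding α g ∧ g.comp i = f

open Classical in
/-- The dimension of `M` over a finite strong substructure `A`: the maximum of
`δ(B) - δ(A)` over the finite `B` with `A ≤ B ≤ M`, and `∞` if there is no maximum. -/
noncomputable def dimOver {M : Type w} [L.Structure M] (A : L.Substructure M) : WithTop ℚ :=
  if h : ∃ q : ℚ, IsGreatest {q : ℚ | ∃ B : L.Substructure M, Finite B ∧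
      StrongSub α A B ∧ StrongIn α B ∧ q = delta α B - delta α A} q
  then ((h.choose : ℚ) : WithTop ℚ) else ⊤

/-- The dimension of `M`, that is, over its empty substructure (`⊥`, as `L` is relational). -/
noncomputable def dim (M : Type w) [L.Structure M] : WithTop ℚ :=
  dimOver α (⊥ : L.Substructure M)

end Rank

section Theory

variable [Fintype (Σ n, L.Relations n)]

open Classical in
/-- The atomic diagram of the finite structure `A`, with a variable for each element of `A`. -/
noncomputable def diagram (A : Type w) [Finite A] [L.Structure A] : L.Formula A :=
  Formula.iInf (fun p : {p : A × A // p.1 ≠ p.2} =>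
      ∼((Term.var p.1.1 : L.Term A).equal (Term.var p.1.2))) ⊓
  Formula.iInf fun E : (Σ n, L.Relations n) => Formula.iInf fun x : Fin E.1 → A =>
    if RelMap E.2 x then E.2.formula fun i => Term.var (x i)
    else ∼(E.2.formula fun i => Term.var (x i))

/-- The sentence saying that `A` does not embed. -/
noncomputable def omitSentence (A : Type w) [Finite A] [L.Structure A] : L.Sentence :=
  ∼(Formula.iExs A ((diagram (L := L) A).relabel (Sum.inr : A → Empty ⊕ A)))

open Classical in
/-- The sentence `∀ x, Δ_A(x) → ∃ y, Δ_{A,B}(x, y)`, where `x` enumerates `A` and `y` enumerates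
the elements of `B` outside `A`. -/
noncomputable def extensionSentence {B : Type w} [Finite B] [L.Structure B]
    (A : L.Substructure B) : L.Sentence :=
  Formula.iAlls A (((diagram (L := L) A).imp
    (Formula.iExs {b : B // b ∉ A} ((diagram (L := L) B).relabel
      (fun b : B => if h : b ∈ A then (Sum.inl ⟨b, h⟩ : A ⊕ {b : B // b ∉ A})
        else Sum.inr ⟨b, h⟩)))).relabel (Sum.inr : A → Empty ⊕ A))

/-- The theory `S_α`: no finite structure outside the class `InKAlpha` embeds, and, for all
`A ≤ B` from the class, every embedding of `A` extends to an embedding of `B`. Every finite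
structure is isomorphic to one with universe `Fin n`. -/
def theoryS (α : (Σ n, L.Relations n) → ℚ) : L.Theory :=
  {φ | ∃ (n : ℕ) (_ : L.Structure (Fin n)), ¬ InKAlpha α (Fin n) ∧ φ = omitSentence (Fin n)} ∪
  {φ | ∃ (n : ℕ) (_ : L.Structure (Fin n)) (A : L.Substructure (Fin n)),
    InKAlpha α (Fin n) ∧ StrongIn α A ∧ φ = extensionSentence A}

end Theory

end BaldwinShi

/-! A structure in $K_L$ is the same thing as a system of labelled finite sets, and $\delta$ becomes
a rank function `rk` on finite vertex sets. This function is submodular, and all its values are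
multiples of $1/c$.

Amalgamation needs nothing beyond the free amalgam: over $A$ it has rank
$\delta(B)+\delta(C)-\delta(A)$, which is $k/c$ when all three ranks are, and both sides stay strong
(`exists_free_amalgam`). Joint embedding and the extension axioms also begin with a free amalgam,
but its rank may exceed $k/c$. The heart of the proof is therefore `exists_extension_rk_eq`, which
lowers the rank of a finite structure to a prescribed multiple of $1/c$ while keeping two given
strong subsets strong.

The rank is lowered by $1/c$ at a time. Let $B$ be strong in $D$ and of smaller rank. By
submodularity the sets of least rank over $B$ are closed under union, so some point $b$ of $D$ lies
in none of them, and every set between $B$ and $D$ through $b$ has rank at least $1/c$ above that of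
$B$ (`Strong.exists_mem_forall_le`). An extension in which only sets through two such points, one
for each strong subset, lose $1/c$ thus does no harm. `exists_rk_drop` constructs it: since $1/c$ is
congruent modulo $1$ to a sum of weights, a chain of new vertices, tied to $D$ by edges of these
weights, changes the rank by exactly $-1/c$. The first edge passes through one point and the last
through the other.

Given this, any embedding of $A$ into a generic extends along $A\le B$: enclose the image in a
strong $C$ from the class, amalgamate freely, lower the rank with $C$ kept strong, and use richness.
The dimension follows from cofinality, uniqueness from back-and-forth started by joint embedding,
and existence from a chain that returns to every extension problem infinitely often. -/

namespace BaldwinShi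

/-! ### Rank and submodularity for systems of labelled edges -/

section EdgeSystems

variable {β : Type*} {V : Type*} {W : Type*}

open Classical in
/-- The labelled edges of `𝓔` that lie inside the finite set `X`. -/
noncomputable def edgesIn [Fintype β] (𝓔 : Set (β × Finset V)) (X : Finset V) :
    Finset (β × Finset V) :=
  ((Finset.univ : Finset β) ×ˢ X.powerset).filter (· ∈ 𝓔)

/-- The rank of a finite set of vertices with respect to the system `𝓔` of labelled edges. -/
noncomputable def rk [Fintype β] (α : β → ℚ) (𝓔 : Set (β × Finset V)) (X : Finset V) : ℚ :=
  (X.card : ℚ) - ∑ e ∈ edgesIn 𝓔 X, α e.1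

/-- `A` has the least rank among the sets between `A` and `X`. -/
def Strong [Fintype β] (α : β → ℚ) (𝓔 : Set (β × Finset V)) (A X : Finset V) : Prop :=
  ∀ Y, A ⊆ Y → Y ⊆ X → rk α 𝓔 A ≤ rk α 𝓔 Y

/-- Two edge systems that have the same edges inside `X`. -/
def AgreeOn (𝓔 𝓕 : Set (β × Finset V)) (X : Finset V) : Prop :=
  ∀ e : β × Finset V, e.2 ⊆ X → (e ∈ 𝓔 ↔ e ∈ 𝓕)

variable {𝓔 𝓕 : Set (β × Finset V)}

theorem AgreeOn.mono {X Y : Finset V} (h : AgreeOn 𝓔 𝓕 X) (hYX : Y ⊆ X) : AgreeOn 𝓔 𝓕 Y :=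
  fun e he => h e (he.trans hYX)

theorem AgreeOn.symm {X : Finset V} (h : AgreeOn 𝓔 𝓕 X) : AgreeOn 𝓕 𝓔 X :=
  fun e he => (h e he).symm

theorem AgreeOn.trans {𝓖 : Set (β × Finset V)} {X : Finset V} (h : AgreeOn 𝓔 𝓕 X)
    (h' : AgreeOn 𝓕 𝓖 X) : AgreeOn 𝓔 𝓖 X :=
  fun e he => (h e he).trans (h' e he)

variable [Fintype β] {α : β → ℚ}

@[simp] theorem mem_edgesIn {X : Finset V} {e : β × Finset V} :
    e ∈ edgesIn 𝓔 X ↔ e.2 ⊆ X ∧ e ∈ 𝓔 := by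
  simp [edgesIn]

theorem edgesIn_congr {X : Finset V} (h : AgreeOn 𝓔 𝓕 X) : edgesIn 𝓔 X = edgesIn 𝓕 X := by
  ext e
  simp only [mem_edgesIn]
  exact and_congr_right fun he => h e he

theorem rk_congr {X : Finset V} (h : AgreeOn 𝓔 𝓕 X) : rk α 𝓔 X = rk α 𝓕 X := by
  rw [rk, rk, edgesIn_congr h]

theorem Strong.congr {A X : Finset V} (h : Strong α 𝓔 A X) (hAX : A ⊆ X)
    (hg : AgreeOn 𝓔 𝓕 X) : Strong α 𝓕 A X := fun Y hAY hYX => by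
  rw [← rk_congr (hg.mono hAX), ← rk_congr (hg.mono hYX)]
  exact h Y hAY hYX

theorem Strong.mono {A X Y : Finset V} (h : Strong α 𝓔 A X) (hYX : Y ⊆ X) : Strong α 𝓔 A Y :=
  fun Z hAZ hZY => h Z hAZ (hZY.trans hYX)

theorem rk_empty (har : ∀ e ∈ 𝓔, 0 < e.2.card) : rk α 𝓔 ∅ = 0 := by
  have : edgesIn 𝓔 (∅ : Finset V) = ∅ := by
    ext e
    simp only [mem_edgesIn, Finset.subset_empty, Finset.notMem_empty, iff_false, not_and]
    intro h he
    have := har e he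
    simp [h] at this
  simp [rk, this]

/-- Edges inside `X` or inside `Y` lie inside the union, and edges inside both lie inside the
intersection. Edges that cross from one set to the other only lower the rank of the union. -/
theorem rk_submodular [DecidableEq V] (hα : ∀ E, 0 ≤ α E) (X Y : Finset V) :
    rk α 𝓔 (X ∪ Y) + rk α 𝓔 (X ∩ Y) ≤ rk α 𝓔 X + rk α 𝓔 Y := by
  classical
  have hcard : ((X ∪ Y).card : ℚ) + (X ∩ Y).card = X.card + Y.card := by
    exact_mod_cast Finset.card_union_add_card_inter X Y
  have hinter : edgesIn 𝓔 (X ∩ Y) = edgesIn 𝓔 X ∩ edgesIn 𝓔 Y := by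
    ext e
    simp only [mem_edgesIn, Finset.mem_inter, Finset.subset_inter_iff]
    tauto
  have hunion : edgesIn 𝓔 X ∪ edgesIn 𝓔 Y ⊆ edgesIn 𝓔 (X ∪ Y) := by
    intro e
    simp only [mem_edgesIn, Finset.mem_union]
    rintro (⟨h, h'⟩ | ⟨h, h'⟩)
    · exact ⟨h.trans Finset.subset_union_left, h'⟩
    · exact ⟨h.trans Finset.subset_union_right, h'⟩
  have h1 := Finset.sum_le_sum_of_subset_of_nonneg (f := fun e : β × Finset V => α e.1) hunion
    fun e _ _ => hα e.1
  have h2 := Finset.sum_union_inter (s₁ := edgesIn 𝓔 X) (s₂ := edgesIn 𝓔 Y)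
    (f := fun e : β × Finset V => α e.1)
  simp only [rk, hinter]
  linarith

theorem rk_modular [DecidableEq V] {X Y : Finset V}
    (h : ∀ e ∈ 𝓔, e.2 ⊆ X ∪ Y → e.2 ⊆ X ∨ e.2 ⊆ Y) :
    rk α 𝓔 (X ∪ Y) + rk α 𝓔 (X ∩ Y) = rk α 𝓔 X + rk α 𝓔 Y := by
  classical
  have hcard : ((X ∪ Y).card : ℚ) + (X ∩ Y).card = X.card + Y.card := by
    exact_mod_cast Finset.card_union_add_card_inter X Y
  have hinter : edgesIn 𝓔 (X ∩ Y) = edgesIn 𝓔 X ∩ edgesIn 𝓔 Y := by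
    ext e
    simp only [mem_edgesIn, Finset.mem_inter, Finset.subset_inter_iff]
    tauto
  have hunion : edgesIn 𝓔 (X ∪ Y) = edgesIn 𝓔 X ∪ edgesIn 𝓔 Y := by
    ext e
    simp only [mem_edgesIn, Finset.mem_union]
    constructor
    · rintro ⟨h1, h2⟩
      exact (h e h2 h1).imp (⟨·, h2⟩) (⟨·, h2⟩)
    · rintro (⟨h, h'⟩ | ⟨h, h'⟩)
      · exact ⟨h.trans Finset.subset_union_left, h'⟩
      · exact ⟨h.trans Finset.subset_union_right, h'⟩
  have h2 := Finset.sum_union_inter (s₁ := edgesIn 𝓔 X) (s₂ := edgesIn 𝓔 Y)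
    (f := fun e : β × Finset V => α e.1)
  simp only [rk, hinter, hunion]
  linarith

/-- Submodularity for `Y` and `A`, combined with the fact that `Y ∪ A` has at least the rank of `A`.
Transitivity of strength and heredity of nonnegative rank both rest on it. -/
theorem Strong.rk_inter_le [DecidableEq V] (hα : ∀ E, 0 ≤ α E) {A X Y : Finset V} (hAX : A ⊆ X)
    (h : Strong α 𝓔 A X) (hYX : Y ⊆ X) : rk α 𝓔 (Y ∩ A) ≤ rk α 𝓔 Y := by
  have h1 := rk_submodular (𝓔 := 𝓔) hα Y A
  have h2 := h (Y ∪ A) Finset.subset_union_right (Finset.union_subset hYX hAX)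
  linarith

theorem Strong.trans (hα : ∀ E, 0 ≤ α E) {A D X : Finset V} (hAD : A ⊆ D) (hDX : D ⊆ X)
    (h : Strong α 𝓔 A D) (h' : Strong α 𝓔 D X) : Strong α 𝓔 A X := by
  classical
  intro Y hAY hYX
  exact (h (Y ∩ D) (Finset.subset_inter hAY hAD) Finset.inter_subset_right).trans
    (h'.rk_inter_le hα hDX hYX)

theorem Strong.nonneg (hα : ∀ E, 0 ≤ α E) {A X : Finset V} (hAX : A ⊆ X)
    (h : Strong α 𝓔 A X) (hA : ∀ Y ⊆ A, 0 ≤ rk α 𝓔 Y) : ∀ Y ⊆ X, 0 ≤ rk α 𝓔 Y := by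
  classical
  intro Y hYX
  exact (hA _ Finset.inter_subset_right).trans (h.rk_inter_le hα hAX hYX)

theorem rk_map {𝓕 : Set (β × Finset W)} (f : V ↪ W) {X : Finset V}
    (h : ∀ (E : β) (s : Finset V), s ⊆ X → ((E, s.map f) ∈ 𝓕 ↔ (E, s) ∈ 𝓔)) :
    rk α 𝓕 (X.map f) = rk α 𝓔 X := by
  classical
  have : edgesIn 𝓕 (X.map f) =
      (edgesIn 𝓔 X).map ((Function.Embedding.refl β).prodMap (Finset.mapEmbedding f).toEmbedding) := by
    ext ⟨E, s⟩
    simp only [mem_edgesIn, Finset.mem_map, Prod.exists, Function.Embedding.prodMap, Prod.map,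
      Function.Embedding.coeFn_mk, Prod.mk.injEq, Function.Embedding.refl_apply]
    constructor
    · rintro ⟨h1, h2⟩
      obtain ⟨t, ht, rfl⟩ := Finset.subset_map_iff.1 h1
      exact ⟨E, t, ⟨ht, (h E t ht).1 h2⟩, rfl, rfl⟩
    · rintro ⟨E', t, ⟨h1, h2⟩, rfl, rfl⟩
      exact ⟨Finset.map_subset_map.2 h1, (h E' t h1).2 h2⟩
  rw [rk, rk, this, Finset.sum_map, Finset.card_map]
  rfl

theorem rk_erase_of_isolated [DecidableEq V] {x : V} {Y : Finset V} (hx : x ∈ Y)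
    (h : ∀ e ∈ 𝓔, x ∉ e.2) : rk α 𝓔 Y = rk α 𝓔 (Y.erase x) + 1 := by
  have : edgesIn 𝓔 Y = edgesIn 𝓔 (Y.erase x) := by
    ext e
    simp only [mem_edgesIn, and_congr_left_iff]
    intro he
    rw [Finset.subset_erase]
    exact ⟨fun h' => ⟨h', h e he⟩, And.left⟩
  rw [rk, rk, this, ← Finset.card_erase_add_one hx]
  push_cast
  ring

theorem rk_insert_edge {E : β} {s : Finset V} (hs : (E, s) ∉ 𝓔) (Y : Finset V)
    [Decidable (s ⊆ Y)] :
    rk α (insert (E, s) 𝓔) Y = rk α 𝓔 Y - if s ⊆ Y then α E else 0 := by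
  classical
  by_cases h : s ⊆ Y
  · have : edgesIn (insert (E, s) 𝓔) Y = insert (E, s) (edgesIn 𝓔 Y) := by
      ext e
      simp only [mem_edgesIn, Set.mem_insert_iff, Finset.mem_insert]
      constructor
      · rintro ⟨h1, h2 | h2⟩
        · exact Or.inl h2
        · exact Or.inr ⟨h1, h2⟩
      · rintro (rfl | ⟨h1, h2⟩)
        · exact ⟨h, Or.inl rfl⟩
        · exact ⟨h1, Or.inr h2⟩
    rw [rk, rk, this, Finset.sum_insert (by simp [hs]), if_pos h]
    ring
  · have : edgesIn (insert (E, s) 𝓔) Y = edgesIn 𝓔 Y := by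
      ext e
      simp only [mem_edgesIn, Set.mem_insert_iff]
      constructor
      · rintro ⟨h1, rfl | h2⟩
        · exact absurd h1 h
        · exact ⟨h1, h2⟩
      · rintro ⟨h1, h2⟩
        exact ⟨h1, Or.inr h2⟩
    rw [rk, rk, this, if_neg h]
    ring

theorem rk_mem_multiples {c : ℕ} (hc : ∀ E, ∃ z : ℤ, (c : ℚ) * α E = z) (X : Finset V) :
    ∃ z : ℤ, (c : ℚ) * rk α 𝓔 X = z := by
  choose z hz using hc
  refine ⟨(c : ℤ) * X.card - ∑ e ∈ edgesIn 𝓔 X, z e.1, ?_⟩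
  rw [rk, mul_sub, Finset.mul_sum]
  push_cast
  simp [hz]

end EdgeSystems

/-! ### Arithmetic of the weights modulo one -/

section Weights

variable {β : Type*}

theorem lcm_den_pos [Fintype β] (α : β → ℚ) : 0 < (Finset.univ.lcm fun E => (α E).den : ℕ) :=
  Nat.pos_of_ne_zero fun h => by
    rw [Finset.lcm_eq_zero_iff] at h
    obtain ⟨E, -, hE⟩ := h
    exact (α E).den_nz hE

theorem lcm_den_mul_eq [Fintype β] (α : β → ℚ) (E : β) :
    ∃ z : ℤ, ((Finset.univ.lcm fun E => (α E).den : ℕ) : ℚ) * α E = z := by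
  obtain ⟨d, hd⟩ : (α E).den ∣ Finset.univ.lcm fun E => (α E).den :=
    Finset.dvd_lcm (Finset.mem_univ E)
  refine ⟨d * (α E).num, ?_⟩
  rw [hd]
  push_cast
  rw [mul_assoc, mul_comm (d : ℚ), ← mul_assoc, Rat.den_mul_eq_num, mul_comm]

/-- Sums of weights, up to an integer. -/
theorem exists_list_sum_eq_inv_lcm [Fintype β] [Nonempty β] (α : β → ℚ) :
    ∃ (l : List β) (E E' : β) (z : ℤ), α E' + (l.map α).sum + α E =
      z + 1 / ((Finset.univ.lcm fun E => (α E).den : ℕ) : ℚ) := by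
  classical
  set c : ℕ := Finset.univ.lcm fun E => (α E).den with hc
  have hcpos : 0 < c := lcm_den_pos α
  -- Only nonnegative multiplicities can be realized by edges, hence a submonoid; `hneg` shows that
  -- it is a group, because `c * q` is an integer and so `-q` equals `(c - 1) * q` up to an integer.
  let H : AddSubmonoid ℚ :=
    { carrier := {q | ∃ (l : List β) (z : ℤ), q = (l.map α).sum + z}
      zero_mem' := ⟨[], 0, by simp⟩
      add_mem' := by
        rintro _ _ ⟨l, z, rfl⟩ ⟨l', z', rfl⟩
        exact ⟨l ++ l', z + z', by simp; ring⟩ }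
  have hint : ∀ z : ℤ, (z : ℚ) ∈ H := fun z => ⟨[], z, by simp⟩
  have hmem : ∀ E, α E ∈ H := fun E => ⟨[E], 0, by simp⟩
  have hcmul : ∀ E, ∃ z : ℤ, (c : ℚ) * α E = z := lcm_den_mul_eq α
  have hHc : ∀ q ∈ H, ∃ z : ℤ, (c : ℚ) * q = z := by
    rintro _ ⟨l, z, rfl⟩
    induction l with
    | nil => exact ⟨c * z, by simp⟩
    | cons E l ih =>
      obtain ⟨x, hx⟩ := ih
      obtain ⟨y, hy⟩ := hcmul E
      refine ⟨x + y, ?_⟩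
      push_cast
      rw [← hx, ← hy]
      simp
      ring
  have hneg : ∀ q ∈ H, -q ∈ H := fun q hq => by
    obtain ⟨z, hz⟩ := hHc q hq
    have h1 : -q = (c - 1) • q + ((-z : ℤ) : ℚ) := by
      rw [nsmul_eq_mul, Nat.cast_sub hcpos]
      push_cast
      rw [← hz]
      ring
    rw [h1]
    exact H.add_mem (H.nsmul_mem hq _) (hint _)
  have hzsmul : ∀ (z : ℤ) (q : ℚ), q ∈ H → (z : ℚ) * q ∈ H := fun z q hq => by
    obtain ⟨n, rfl | rfl⟩ := z.eq_nat_or_neg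
    · have := H.nsmul_mem hq n
      rwa [nsmul_eq_mul] at this
    · have := hneg _ (H.nsmul_mem hq n)
      rw [nsmul_eq_mul] at this
      push_cast
      rwa [neg_mul]
  have hden : ∀ E, 1 / ((α E).den : ℚ) ∈ H := fun E => by
    have hco : Int.gcd (α E).num (α E).den = 1 := (α E).reduced
    have hb := Int.gcd_eq_gcd_ab (α E).num (α E).den
    rw [hco] at hb
    have hb' : (1 : ℚ) = (α E).num * (Int.gcdA (α E).num (α E).den : ℤ) +
        (α E).den * (Int.gcdB (α E).num (α E).den : ℤ) := by exact_mod_cast hb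
    have hd : ((α E).den : ℚ) ≠ 0 := by exact_mod_cast (α E).den_nz
    have : 1 / ((α E).den : ℚ) = (Int.gcdA (α E).num (α E).den : ℤ) * α E +
        (Int.gcdB (α E).num (α E).den : ℤ) := by
      rw [div_eq_iff hd, add_mul, mul_assoc, Rat.mul_den_eq_num]
      rw [hb']
      ring
    rw [this]
    exact H.add_mem (hzsmul _ _ (hmem E)) (hint _)
  -- Bézout for the denominators: the reciprocal of a least common multiple is an integer
  -- combination of the two reciprocals.
  have hlcm : ∀ s : Finset β, 1 / ((s.lcm fun E => (α E).den : ℕ) : ℚ) ∈ H := fun s => by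
    induction s using Finset.induction_on with
    | empty => simpa using hint 1
    | insert E s hE ih =>
      rw [Finset.lcm_insert]
      set a := (α E).den with ha
      set b := s.lcm fun E => (α E).den with hb
      have ha0 : (a : ℚ) ≠ 0 := by exact_mod_cast (α E).den_nz
      have hb0 : (b : ℚ) ≠ 0 := by
        intro h
        have h' : b = 0 := by exact_mod_cast h
        rw [hb, Finset.lcm_eq_zero_iff] at h'
        obtain ⟨E, -, hE⟩ := h'
        exact (α E).den_nz hE
      have hbez : ((Nat.gcd a b : ℕ) : ℚ) = a * (Nat.gcdA a b : ℤ) + b * (Nat.gcdB a b : ℤ) := by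
        exact_mod_cast Nat.gcd_eq_gcd_ab a b
      have hgl : ((Nat.gcd a b : ℕ) : ℚ) * (Nat.lcm a b : ℕ) = a * b := by
        exact_mod_cast Nat.gcd_mul_lcm a b
      have hl0 : ((Nat.lcm a b : ℕ) : ℚ) ≠ 0 := by
        intro h
        rw [h, mul_zero] at hgl
        exact mul_ne_zero ha0 hb0 hgl.symm
      have : 1 / ((GCDMonoid.lcm a b : ℕ) : ℚ) =
          (Nat.gcdB a b : ℤ) * (1 / (a : ℚ)) + (Nat.gcdA a b : ℤ) * (1 / (b : ℚ)) := by
        change 1 / ((Nat.lcm a b : ℕ) : ℚ) = _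
        rw [hbez] at hgl
        field_simp
        linarith
      rw [this]
      exact H.add_mem (hzsmul _ _ (hden E)) (hzsmul _ _ ih)
  obtain ⟨E⟩ := ‹Nonempty β›
  -- Two weights are set aside, for the first and the last edge of the gadget.
  obtain ⟨l, z, hl⟩ : 1 / (c : ℚ) - α E - α E ∈ H := by
    rw [sub_eq_add_neg, sub_eq_add_neg]
    exact H.add_mem (H.add_mem (hlcm Finset.univ) (hneg _ (hmem E))) (hneg _ (hmem E))
  refine ⟨l, E, E, -z, ?_⟩
  push_cast
  linarith

end Weights

/-! ### The gadget that lowers the rank by `1 / c` -/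

section Gadget

variable {β : Type*} {V : Type*} [Fintype β] [DecidableEq V]

/-- A stage in the construction of an extension of `D` whose rank drops by `1 / c`. The rank of
the extension `X` is that of `D` plus the residual `ρ`; sets that lose part of the residual have to
contain the current vertex `v`, and those that miss `b'` keep an excess of `1 / c`. The edges that
were added meet `D` inside `U`. -/
structure Stage (α : β → ℚ) (ar : β → ℕ) (c : ℕ) (𝓓 : Set (β × Finset V)) (D : Finset V)
    (b b' : V) (𝓔 : Set (β × Finset V)) (X : Finset V) (v : V) (ρ : ℚ) (U : Finset V) :
    Prop where
  subset : D ⊆ X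
  mem : v ∈ X
  notMem : v ∉ D
  card_eq : ∀ e ∈ 𝓔, e.2.card = ar e.1
  supp : ∀ e ∈ 𝓔, e.2 ⊆ X
  agree : AgreeOn 𝓔 𝓓 D
  used : ∀ e ∈ 𝓔, ¬ e.2 ⊆ D → e.2 ∩ D ⊆ U
  notMem_used : b ∉ U
  rk_eq : rk α 𝓔 X = rk α 𝓔 D + ρ
  le_rk : ∀ Y ⊆ X, v ∉ Y → rk α 𝓔 (Y ∩ D) ≤ rk α 𝓔 Y
  le_rk_of_mem : ∀ Y ⊆ X, v ∈ Y → rk α 𝓔 (Y ∩ D) + ρ ≤ rk α 𝓔 Y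
  le_rk_of_notMem : ∀ Y ⊆ X, v ∈ Y → b' ∉ Y → rk α 𝓔 (Y ∩ D) + ρ + 1 / c ≤ rk α 𝓔 Y
  nonneg : 0 ≤ ρ
  lt_one : ρ < 1
  mul_eq : ∃ z : ℤ, (c : ℚ) * ρ = z

theorem inv_le_of_multiple {c : ℕ} (hc : 0 < c) {q : ℚ} (hq : 0 < q)
    (h : ∃ z : ℤ, (c : ℚ) * q = z) : 1 / (c : ℚ) ≤ q := by
  obtain ⟨z, hz⟩ := h
  have hc' : (0 : ℚ) < c := by exact_mod_cast hc
  rw [div_le_iff₀ hc', mul_comm, hz]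
  have : (0 : ℚ) < z := hz ▸ mul_pos hc' hq
  have h' : 0 < z := by exact_mod_cast this
  exact_mod_cast h'

variable {α : β → ℚ} {ar : β → ℕ} {c : ℕ} {𝓓 𝓔 : Set (β × Finset V)} {D X U : Finset V}
  {b b' v : V} {ρ : ℚ}

/-- The first edge joins a new vertex to points of `D` that include `b'` and avoid `b`. A set with
the new vertex but without `b'` misses this edge and keeps its whole weight, which is at least `1 /
c`; `b` is saved for the last edge. -/
theorem Stage.init [Infinite V] (hα : ∀ E, 0 < α E ∧ α E < 1) (har : ∀ E, 2 ≤ ar E) (hc : 0 < c)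
    (hcα : ∀ E, ∃ z : ℤ, (c : ℚ) * α E = z) (h𝓓 : ∀ e ∈ 𝓓, e.2.card = ar e.1) (hb : b ∈ D)
    (hb' : b' ∈ D) (hbb : b ≠ b') (E : β) (hD : ar E ≤ D.card) :
    ∃ 𝓔 X v U, Stage α ar c 𝓓 D b b' 𝓔 X v (1 - α E) U ∧ U.card ≤ ar E := by
  obtain ⟨v, hv⟩ := Infinite.exists_notMem_finset D
  have h1 : ({b'} : Finset V) ⊆ D.erase b := by
    simp [hbb.symm, hb']
  have h2 : (D.erase b).card = D.card - 1 := Finset.card_erase_of_mem hb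
  have h3 := har E
  obtain ⟨B, hB1, hB2, hB3⟩ := Finset.exists_subsuperset_card_eq h1 (n := ar E - 1)
    (by simp; omega) (by omega)
  have hBD : B ⊆ D := hB2.trans (Finset.erase_subset _ _)
  have hvB : v ∉ B := fun h => hv (hBD h)
  set 𝓕 : Set (β × Finset V) := {e | e ∈ 𝓓 ∧ e.2 ⊆ D} with h𝓕
  set s := insert v B with hs
  have hsD : ∀ Y, v ∉ Y → ¬ s ⊆ Y := fun Y hY h => hY (h (Finset.mem_insert_self v B))
  have hs𝓕 : (E, s) ∉ 𝓕 := fun h => hsD D hv h.2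
  have hagree : AgreeOn (insert (E, s) 𝓕) 𝓓 D := by
    intro e he
    simp only [Set.mem_insert_iff, h𝓕, Set.mem_ofPred_eq]
    constructor
    · rintro (rfl | h)
      · exact absurd he (hsD D hv)
      · exact h.1
    · exact fun h => Or.inr ⟨h, he⟩
  have hiso : ∀ e ∈ 𝓕, v ∉ e.2 := fun e he h => hv (he.2 h)
  have hrk : ∀ Y, v ∉ Y → rk α (insert (E, s) 𝓕) Y = rk α 𝓕 Y := fun Y hY => by
    rw [rk_insert_edge hs𝓕, if_neg (hsD Y hY), sub_zero]
  have hrk' : ∀ Y ⊆ insert v D, v ∈ Y → rk α (insert (E, s) 𝓕) Y =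
      rk α (insert (E, s) 𝓕) (Y ∩ D) + 1 - if s ⊆ Y then α E else 0 := fun Y hY hvY => by
    have hYD : Y ∩ D = Y.erase v := by
      ext x
      simp only [Finset.mem_inter, Finset.mem_erase]
      constructor
      · rintro ⟨h, h'⟩
        exact ⟨fun hx => hv (hx ▸ h'), h⟩
      · rintro ⟨h, h'⟩
        exact ⟨h', (Finset.mem_insert.1 (hY h')).resolve_left h⟩
    rw [hrk (Y ∩ D) (by simp [hv]), rk_insert_edge hs𝓕, rk_erase_of_isolated hvY hiso, hYD]
  have hαc := inv_le_of_multiple hc (hα E).1 (hcα E)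
  refine ⟨insert (E, s) 𝓕, insert v D, v, B, ⟨Finset.subset_insert _ _,
    Finset.mem_insert_self _ _, hv, ?_, ?_, hagree, ?_, fun h => by simpa using hB2 h, ?_, ?_, ?_,
    ?_, by linarith [hα E],
    by linarith [hα E], ?_⟩, by omega⟩
  · rintro e (rfl | h)
    · rw [hs, Finset.card_insert_of_notMem hvB]
      dsimp only
      omega
    · exact h𝓓 e h.1
  · rintro e (rfl | h)
    · exact Finset.insert_subset_insert v hBD
    · exact h.2.trans (Finset.subset_insert _ _)
  · rintro e (rfl | h) he
    · rw [hs, Finset.insert_inter_of_notMem hv]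
      exact Finset.inter_subset_left
    · exact absurd h.2 he
  · rw [hrk' _ subset_rfl (Finset.mem_insert_self _ _), if_pos (Finset.insert_subset_insert v hBD),
      Finset.inter_eq_right.2 (Finset.subset_insert v D)]
    ring
  · intro Y hY hvY
    rw [Finset.inter_eq_left.2]
    intro x hx
    exact (Finset.mem_insert.1 (hY hx)).resolve_left fun h => hvY (h ▸ hx)
  · intro Y hY hvY
    rw [hrk' Y hY hvY]
    split_ifs <;> linarith [hα E]
  · intro Y hY hvY hbY
    rw [hrk' Y hY hvY, if_neg]
    · linarith
    · exact fun h => hbY (h (Finset.mem_insert_of_mem (hB1 (Finset.mem_singleton_self b'))))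
  · obtain ⟨z, hz⟩ := hcα E
    exact ⟨c - z, by push_cast; rw [← hz]; ring⟩

theorem exists_subset_disjoint_notMem (D U : Finset V) (b : V) (n : ℕ)
    (hD : U.card + (n + 1) ≤ D.card) :
    ∃ B ⊆ D, B.card = n ∧ b ∉ B ∧ Disjoint B U := by
  have h1 : D.card ≤ ((D \ U).erase b).card + 1 + U.card := by
    have h2 := Finset.le_card_sdiff U D
    have h3 := Finset.pred_card_le_card_erase (s := D \ U) (a := b)
    omega
  obtain ⟨B, hB, hB'⟩ := Finset.exists_subset_card_eq (s := (D \ U).erase b) (n := n) (by omega)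
  refine ⟨B, fun x hx => ?_, hB', fun hx => by simpa using hB hx, ?_⟩
  · exact (Finset.mem_sdiff.1 (Finset.mem_of_mem_erase (hB hx))).1
  · rw [Finset.disjoint_left]
    exact fun x hx => (Finset.mem_sdiff.1 (Finset.mem_of_mem_erase (hB hx))).2

/-- As long as the residual can pay for the weight, the edge is hung on the current vertex. Its
other points are taken from `D` outside `U`; there is at least one, so the edge is not already
present. -/
theorem Stage.add_edge (hα : ∀ E, 0 < α E ∧ α E < 1) (har : ∀ E, 2 ≤ ar E)
    (hcα : ∀ E, ∃ z : ℤ, (c : ℚ) * α E = z)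
    (h : Stage α ar c 𝓓 D b b' 𝓔 X v ρ U) (E : β) (hD : U.card + ar E ≤ D.card) (hE : α E ≤ ρ) :
    ∃ 𝓔' U', Stage α ar c 𝓓 D b b' 𝓔' X v (ρ - α E) U' ∧ U'.card ≤ U.card + ar E := by
  have h2 := har E
  obtain ⟨B, hBD, hBc, hbB, hBU⟩ := exists_subset_disjoint_notMem D U b (ar E - 1) (by omega)
  have hvB : v ∉ B := fun hv => h.notMem (hBD hv)
  set s := insert v B with hs
  have hsY : ∀ Y, v ∉ Y → ¬ s ⊆ Y := fun Y hY hsub => hY (hsub (Finset.mem_insert_self v B))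
  have hsD : s ∩ D = B := by
    rw [hs, Finset.insert_inter_of_notMem h.notMem, Finset.inter_eq_left.2 hBD]
  have hs𝓔 : (E, s) ∉ 𝓔 := fun hmem => by
    have h3 := h.used _ hmem (hsY D h.notMem)
    rw [hsD] at h3
    have h4 : B = ∅ := Finset.disjoint_self_iff_empty B |>.1 (hBU.mono_right h3)
    rw [h4, Finset.card_empty] at hBc
    omega
  have hrk : ∀ Y, v ∉ Y → rk α (insert (E, s) 𝓔) Y = rk α 𝓔 Y := fun Y hY => by
    rw [rk_insert_edge hs𝓔, if_neg (hsY Y hY), sub_zero]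
  have hrkD : ∀ Y, rk α (insert (E, s) 𝓔) (Y ∩ D) = rk α 𝓔 (Y ∩ D) := fun Y =>
    hrk _ (by simp [h.notMem])
  have hrk' : ∀ Y, rk α 𝓔 Y - α E ≤ rk α (insert (E, s) 𝓔) Y := fun Y => by
    rw [rk_insert_edge hs𝓔]
    split_ifs <;> linarith [hα E]
  have hsX : s ⊆ X := Finset.insert_subset h.mem (hBD.trans h.subset)
  refine ⟨insert (E, s) 𝓔, U ∪ B, ⟨h.subset, h.mem, h.notMem, ?_, ?_, ?_, ?_, ?_, ?_, ?_, ?_, ?_,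
    by linarith, by linarith [hα E, h.lt_one], ?_⟩, (Finset.card_union_le _ _).trans (by omega)⟩
  · rintro e (rfl | he)
    · rw [hs, Finset.card_insert_of_notMem hvB]
      dsimp only
      omega
    · exact h.card_eq e he
  · rintro e (rfl | he)
    · exact hsX
    · exact h.supp e he
  · intro e he
    rw [← h.agree e he, Set.mem_insert_iff, or_iff_right]
    rintro rfl
    exact hsY D h.notMem he
  · rintro e (rfl | he) heD
    · exact hsD.subset.trans Finset.subset_union_right
    · exact (h.used e he heD).trans Finset.subset_union_left
  · simp [h.notMem_used, hbB]
  · rw [hrk D h.notMem, rk_insert_edge hs𝓔, if_pos hsX, h.rk_eq]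
    ring
  · intro Y hY hvY
    rw [hrkD, hrk Y hvY]
    exact h.le_rk Y hY hvY
  · intro Y hY hvY
    rw [hrkD]
    linarith [hrk' Y, h.le_rk_of_mem Y hY hvY]
  · intro Y hY hvY hbY
    rw [hrkD]
    linarith [hrk' Y, h.le_rk_of_notMem Y hY hvY hbY]
  · obtain ⟨z, hz⟩ := hcα E
    obtain ⟨y, hy⟩ := h.mul_eq
    exact ⟨y - z, by push_cast; rw [← hz, ← hy]; ring⟩

/-- If the weight exceeds the residual, a new vertex pays for it and becomes the current one. A set
that contains it but not `v` misses the new edge, so it exceeds the new residual by `α E - ρ`, a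
positive multiple of `1 / c`; this preserves the excess of the sets without `b'`. -/
theorem Stage.add_vertex [Infinite V] (hα : ∀ E, 0 < α E ∧ α E < 1) (har : ∀ E, 2 ≤ ar E)
    (hc : 0 < c) (hcα : ∀ E, ∃ z : ℤ, (c : ℚ) * α E = z)
    (h : Stage α ar c 𝓓 D b b' 𝓔 X v ρ U) (E : β) (hD : U.card + ar E ≤ D.card) (hE : ρ < α E) :
    ∃ 𝓔' X' v' U', Stage α ar c 𝓓 D b b' 𝓔' X' v' (ρ + 1 - α E) U' ∧
      U'.card ≤ U.card + ar E := by
  have h2 := har E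
  obtain ⟨B, hBD, hBc, hbB, hBU⟩ := exists_subset_disjoint_notMem D U b (ar E - 2) (by omega)
  have hvB : v ∉ B := fun hv => h.notMem (hBD hv)
  obtain ⟨x, hx⟩ := Infinite.exists_notMem_finset X
  have hxD : x ∉ D := fun hxD => hx (h.subset hxD)
  have hxB : x ∉ insert v B := fun hxB => hx
    (Finset.insert_subset h.mem (hBD.trans h.subset) hxB)
  set s := insert x (insert v B) with hs
  have hsY : ∀ Y, x ∉ Y → ¬ s ⊆ Y := fun Y hY h => hY (h (Finset.mem_insert_self x _))
  have hsY' : ∀ Y, v ∉ Y → ¬ s ⊆ Y := fun Y hY h =>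
    hY (h (Finset.mem_insert_of_mem (Finset.mem_insert_self v B)))
  have hsD : s ∩ D = B := by
    rw [hs, Finset.insert_inter_of_notMem hxD, Finset.insert_inter_of_notMem h.notMem,
      Finset.inter_eq_left.2 hBD]
  have hs𝓔 : (E, s) ∉ 𝓔 := fun hmem => hsY X hx (h.supp _ hmem)
  have hiso : ∀ e ∈ 𝓔, x ∉ e.2 := fun e he hxe => hx (h.supp e he hxe)
  have hrk : ∀ Y, x ∉ Y → rk α (insert (E, s) 𝓔) Y = rk α 𝓔 Y := fun Y hY => by
    rw [rk_insert_edge hs𝓔, if_neg (hsY Y hY), sub_zero]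
  have hrkD : ∀ Y, rk α (insert (E, s) 𝓔) (Y ∩ D) = rk α 𝓔 (Y ∩ D) := fun Y =>
    hrk _ (by simp [hxD])
  have hrk' : ∀ Y, x ∈ Y → rk α (insert (E, s) 𝓔) Y =
      rk α 𝓔 (Y.erase x) + 1 - if s ⊆ Y then α E else 0 := fun Y hxY => by
    rw [rk_insert_edge hs𝓔, rk_erase_of_isolated hxY hiso]
  have hsX : s ⊆ insert x X := Finset.insert_subset_insert x
    (Finset.insert_subset h.mem (hBD.trans h.subset))
  have herase : ∀ Y ⊆ insert x X, Y.erase x ⊆ X := fun Y hY =>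
    Finset.subset_insert_iff.1 hY
  have hED : ∀ Y : Finset V, Y ∩ D = Y.erase x ∩ D := fun Y => by
    rw [Finset.erase_inter, Finset.erase_eq_of_notMem]
    simp [hxD]
  obtain ⟨z, hz⟩ := hcα E
  obtain ⟨y, hy⟩ := h.mul_eq
  have hgap : 1 / (c : ℚ) ≤ α E - ρ := inv_le_of_multiple hc (by linarith)
    ⟨z - y, by push_cast; rw [← hz, ← hy]; ring⟩
  have hcinv : (0 : ℚ) ≤ 1 / c := by positivity
  have hle : ∀ Y ⊆ X, rk α 𝓔 (Y ∩ D) ≤ rk α 𝓔 Y := fun Y hY => by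
    by_cases hv : v ∈ Y
    · linarith [h.le_rk_of_mem Y hY hv, h.nonneg]
    · exact h.le_rk Y hY hv
  refine ⟨insert (E, s) 𝓔, insert x X, x, U ∪ B,
    ⟨h.subset.trans (Finset.subset_insert _ _), Finset.mem_insert_self _ _, hxD,
    ?_, ?_, ?_, ?_, ?_, ?_, ?_, ?_, ?_,
    by linarith [h.nonneg, hα E], by linarith, ?_⟩, (Finset.card_union_le _ _).trans (by omega)⟩
  · rintro e (rfl | he)
    · rw [hs, Finset.card_insert_of_notMem hxB, Finset.card_insert_of_notMem hvB]
      dsimp only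
      omega
    · exact h.card_eq e he
  · rintro e (rfl | he)
    · exact hsX
    · exact (h.supp e he).trans (Finset.subset_insert _ _)
  · intro e he
    rw [← h.agree e he, Set.mem_insert_iff, or_iff_right]
    rintro rfl
    exact hsY D hxD he
  · rintro e (rfl | he) heD
    · exact hsD.subset.trans Finset.subset_union_right
    · exact (h.used e he heD).trans Finset.subset_union_left
  · simp [h.notMem_used, hbB]
  · rw [hrk D hxD, hrk' _ (Finset.mem_insert_self x X), if_pos hsX, Finset.erase_insert hx, h.rk_eq]
    ring
  · intro Y hY hxY
    have hYX : Y ⊆ X := by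
      have := herase Y hY
      rwa [Finset.erase_eq_of_notMem hxY] at this
    rw [hrkD, hrk Y hxY]
    exact hle Y hYX
  · intro Y hY hxY
    rw [hrkD, hrk' Y hxY, hED]
    by_cases hv : v ∈ Y.erase x
    · have := h.le_rk_of_mem _ (herase Y hY) hv
      split_ifs <;> linarith [hα E]
    · rw [if_neg]
      · linarith [hle _ (herase Y hY)]
      · intro hsub
        exact hsY' _ (fun hvY => hv (Finset.mem_erase.2 ⟨fun hvx => hx (hvx ▸ h.mem), hvY⟩)) hsub
  · intro Y hY hxY hbY
    rw [hrkD, hrk' Y hxY, hED]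
    by_cases hv : v ∈ Y.erase x
    · have := h.le_rk_of_notMem _ (herase Y hY) hv fun hb => hbY (Finset.mem_of_mem_erase hb)
      split_ifs <;> linarith [hα E]
    · rw [if_neg]
      · linarith [hle _ (herase Y hY)]
      · intro hsub
        exact hsY' _ (fun hvY => hv (Finset.mem_erase.2 ⟨fun hvx => hx (hvx ▸ h.mem), hvY⟩)) hsub
  · exact ⟨y + c - z, by push_cast; rw [← hz, ← hy]; ring⟩

/-- Each weight is spent by an edge, with a new vertex exactly when needed, so the residual is
determined modulo one; `z` counts the added vertices. -/
theorem Stage.run [Infinite V] (hα : ∀ E, 0 < α E ∧ α E < 1) (har : ∀ E, 2 ≤ ar E)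
    (hc : 0 < c) (hcα : ∀ E, ∃ z : ℤ, (c : ℚ) * α E = z) (l : List β) :
    ∀ {𝓔 X v ρ U}, Stage α ar c 𝓓 D b b' 𝓔 X v ρ U → U.card + (l.map ar).sum ≤ D.card →
    ∃ (𝓔' : Set (β × Finset V)) (X' : Finset V) (v' : V) (ρ' : ℚ) (U' : Finset V) (z : ℤ),
      Stage α ar c 𝓓 D b b' 𝓔' X' v' ρ' U' ∧
      U'.card ≤ U.card + (l.map ar).sum ∧ ρ' = ρ - (l.map α).sum + z := by
  induction l with
  | nil => exact fun {𝓔 X v ρ U} h _ => ⟨𝓔, X, v, ρ, U, 0, h, by simp, by simp⟩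
  | cons E l ih =>
    intro 𝓔 X v ρ U h hD
    simp only [List.map_cons, List.sum_cons] at hD ⊢
    rcases le_or_gt (α E) ρ with hE | hE
    · obtain ⟨𝓔₁, U₁, h₁, hU₁⟩ := h.add_edge hα har hcα E (by omega) hE
      obtain ⟨𝓔', X', v', ρ', U', z, h', hU', hρ⟩ := ih h₁ (by omega)
      exact ⟨𝓔', X', v', ρ', U', z, h', by omega, by rw [hρ]; ring⟩
    · obtain ⟨𝓔₁, X₁, v₁, U₁, h₁, hU₁⟩ := h.add_vertex hα har hc hcα E (by omega) hE
      obtain ⟨𝓔', X', v', ρ', U', z, h', hU', hρ⟩ := ih h₁ (by omega)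
      exact ⟨𝓔', X', v', ρ', U', z + 1, h', by omega, by rw [hρ]; push_cast; ring⟩

/-- The last edge goes through `v` and `b` and costs `1 / c` more than the residual. Sets without
`b` do not contain it, and for sets without `b'` the stored excess makes up the deficit. -/
theorem Stage.finish (hα : ∀ E, 0 < α E ∧ α E < 1) (har : ∀ E, 2 ≤ ar E) (hb : b ∈ D)
    (h : Stage α ar c 𝓓 D b b' 𝓔 X v ρ U) (E : β) (hD : U.card + ar E ≤ D.card)
    (hE : α E = ρ + 1 / c) :
    ∃ 𝓔' : Set (β × Finset V), D ⊆ X ∧ (∀ e ∈ 𝓔', e.2.card = ar e.1) ∧ AgreeOn 𝓔' 𝓓 D ∧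
      rk α 𝓔' X = rk α 𝓔' D - 1 / c ∧
      (∀ Y ⊆ X, rk α 𝓔' (Y ∩ D) - 1 / c ≤ rk α 𝓔' Y) ∧
      (∀ Y ⊆ X, ¬ (b ∈ Y ∧ b' ∈ Y) → rk α 𝓔' (Y ∩ D) ≤ rk α 𝓔' Y) := by
  have h2 := har E
  obtain ⟨B₀, hBD₀, hBc₀, hbB₀, hBU₀⟩ := exists_subset_disjoint_notMem D U b (ar E - 2) (by omega)
  obtain ⟨B, hB⟩ : ∃ B, B = insert b B₀ := ⟨_, rfl⟩
  have hbB : b ∈ B := hB ▸ Finset.mem_insert_self _ _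
  have hBD : B ⊆ D := hB ▸ Finset.insert_subset hb hBD₀
  have hBc : B.card = ar E - 1 := by
    rw [hB, Finset.card_insert_of_notMem hbB₀]
    omega
  have hvB : v ∉ B := fun hv => h.notMem (hBD hv)
  set s := insert v B with hs
  have hsY : ∀ Y, v ∉ Y → ¬ s ⊆ Y := fun Y hY hsub => hY (hsub (Finset.mem_insert_self v B))
  have hsD : s ∩ D = B := by
    rw [hs, Finset.insert_inter_of_notMem h.notMem, Finset.inter_eq_left.2 hBD]
  have hs𝓔 : (E, s) ∉ 𝓔 := fun hmem => by
    have h3 := h.used _ hmem (hsY D h.notMem)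
    rw [hsD] at h3
    exact h.notMem_used (h3 hbB)
  have hrk : ∀ Y, v ∉ Y → rk α (insert (E, s) 𝓔) Y = rk α 𝓔 Y := fun Y hY => by
    rw [rk_insert_edge hs𝓔, if_neg (hsY Y hY), sub_zero]
  have hrkD : ∀ Y, rk α (insert (E, s) 𝓔) (Y ∩ D) = rk α 𝓔 (Y ∩ D) := fun Y =>
    hrk _ (by simp [h.notMem])
  have hrk' : ∀ Y, rk α 𝓔 Y - α E ≤ rk α (insert (E, s) 𝓔) Y := fun Y => by
    rw [rk_insert_edge hs𝓔]
    split_ifs <;> linarith [hα E]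
  have hsX : s ⊆ X := Finset.insert_subset h.mem (hBD.trans h.subset)
  have hcinv : (0 : ℚ) ≤ 1 / c := by positivity
  refine ⟨insert (E, s) 𝓔, h.subset, ?_, ?_, ?_, ?_, ?_⟩
  · rintro e (rfl | he)
    · rw [hs, Finset.card_insert_of_notMem hvB]
      dsimp only
      omega
    · exact h.card_eq e he
  · intro e he
    rw [← h.agree e he, Set.mem_insert_iff, or_iff_right]
    rintro rfl
    exact hsY D h.notMem he
  · rw [hrk D h.notMem, rk_insert_edge hs𝓔, if_pos hsX, h.rk_eq]
    linarith
  · intro Y hY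
    rw [hrkD]
    by_cases hv : v ∈ Y
    · linarith [hrk' Y, h.le_rk_of_mem Y hY hv]
    · rw [hrk Y hv]
      linarith [h.le_rk Y hY hv]
  · intro Y hY hbb
    rw [hrkD]
    by_cases hv : v ∈ Y
    · by_cases hbY : b ∈ Y
      · linarith [hrk' Y, h.le_rk_of_notMem Y hY hv fun hb' => hbb ⟨hbY, hb'⟩]
      · rw [rk_insert_edge hs𝓔, if_neg fun hsub => hbY (hsub (Finset.mem_insert_of_mem hbB))]
        linarith [h.le_rk_of_mem Y hY hv, h.nonneg]
    · rw [hrk Y hv]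
      exact h.le_rk Y hY hv

end Gadget

/-! ### Lowering the rank while keeping two subsets strong -/

section Descent

variable {β : Type*} {V : Type*} [Fintype β] {α : β → ℚ} {ar : β → ℕ} {𝓓 : Set (β × Finset V)}

/-- A large finite set `D` has an extension of rank `1 / c` less in which only the sets that contain
two prescribed points `b` and `b'` drop in rank. -/
theorem exists_rk_drop [DecidableEq V] [Infinite V] [Nonempty β] (hα : ∀ E, 0 < α E ∧ α E < 1)
    (har : ∀ E, 2 ≤ ar E) {c : ℕ} (hc : c = Finset.univ.lcm fun E => (α E).den) :
    ∃ N, 2 ≤ N ∧ ∀ (𝓓 : Set (β × Finset V)) (D : Finset V) (b b' : V),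
      (∀ e ∈ 𝓓, e.2.card = ar e.1) → b ∈ D → b' ∈ D → b ≠ b' → N ≤ D.card →
      ∃ (𝓔 : Set (β × Finset V)) (X : Finset V), D ⊆ X ∧ (∀ e ∈ 𝓔, e.2.card = ar e.1) ∧
        AgreeOn 𝓔 𝓓 D ∧ rk α 𝓔 X = rk α 𝓔 D - 1 / c ∧
        (∀ Y ⊆ X, rk α 𝓔 (Y ∩ D) - 1 / c ≤ rk α 𝓔 Y) ∧
        (∀ Y ⊆ X, ¬ (b ∈ Y ∧ b' ∈ Y) → rk α 𝓔 (Y ∩ D) ≤ rk α 𝓔 Y) := by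
  have hc0 : 0 < c := hc ▸ lcm_den_pos α
  have hcα : ∀ E, ∃ z : ℤ, (c : ℚ) * α E = z := hc ▸ lcm_den_mul_eq α
  obtain ⟨l, E, E', z, hz⟩ := exists_list_sum_eq_inv_lcm α
  rw [← hc] at hz
  -- Room for all edges of the gadget to use disjoint parts of `D`.
  refine ⟨ar E' + (l.map ar).sum + ar E, by have := har E; omega,
    fun 𝓓 D b b' h𝓓 hb hb' hbb hN => ?_⟩
  obtain ⟨𝓔₀, X₀, v₀, U₀, h₀, hU₀⟩ := Stage.init hα har hc0 hcα h𝓓 hb hb' hbb E' (by omega)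
  obtain ⟨𝓔₁, X₁, v₁, ρ, U₁, y, h₁, hU₁, hρ⟩ := h₀.run hα har hc0 hcα l (by omega)
  -- Both `ρ` and `α E - 1 / c` lie in the interval from 0 (included) to 1 (excluded), and they
  -- differ by an integer.
  have hE : α E = ρ + 1 / c := by
    have h1 : ρ = α E - 1 / c + (1 + y - z : ℤ) := by
      push_cast
      linarith
    have h2 := inv_le_of_multiple hc0 (hα E).1 (hcα E)
    have h3 : (0 : ℚ) ≤ 1 / c := by positivity
    have h4 : ((1 + y - z : ℤ) : ℚ) < (1 : ℤ) := by
      push_cast at h1 ⊢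
      linarith [h₁.lt_one]
    have h5 : ((-1 : ℤ) : ℚ) < (1 + y - z : ℤ) := by
      push_cast at h1 ⊢
      linarith [h₁.nonneg, hα E]
    have h6 : 1 + y - z = 0 := by
      have h4' := Int.cast_lt.1 h4
      have h5' := Int.cast_lt.1 h5
      omega
    rw [h6] at h1
    push_cast at h1
    linarith
  obtain ⟨𝓔, h⟩ := h₁.finish hα har hb E (by omega) hE
  exact ⟨𝓔, X₁, h⟩

/-- If `D` has larger rank than its strong subset `B`, some point of `D` is not in any set of least
rank over `B`. -/
theorem Strong.exists_mem_forall_le (hα : ∀ E, 0 ≤ α E) {c : ℕ} (hc : 0 < c)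
    (hcα : ∀ E, ∃ z : ℤ, (c : ℚ) * α E = z) {B D : Finset V} (hBD : B ⊆ D)
    (h : Strong α 𝓓 B D) (hlt : rk α 𝓓 B < rk α 𝓓 D) :
    ∃ b ∈ D, ∀ Y, B ⊆ Y → Y ⊆ D → b ∈ Y → rk α 𝓓 B + 1 / c ≤ rk α 𝓓 Y := by
  classical
  -- `T` is a largest set of least rank over `B`. By submodularity its union with another such set
  -- again has least rank, so `T` contains them all, and any point of `D` outside `T` will do.
  obtain ⟨T, hT, hmax⟩ := Finset.exists_max_image
    (D.powerset.filter fun Y => B ⊆ Y ∧ rk α 𝓓 Y = rk α 𝓓 B) Finset.card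
    ⟨B, by simp [hBD]⟩
  simp only [Finset.mem_filter, Finset.mem_powerset] at hT hmax
  obtain ⟨hTD, hBT, hrkT⟩ := hT
  have hne : ¬ D ⊆ T := fun hDT => by
    rw [hDT.antisymm hTD, hrkT] at hlt
    exact hlt.false
  obtain ⟨b, hbD, hbT⟩ := Finset.not_subset.1 hne
  refine ⟨b, hbD, fun Y hBY hYD hbY => ?_⟩
  rcases (h Y hBY hYD).lt_or_eq with hlt' | heq
  · have h1 := inv_le_of_multiple hc (sub_pos.2 hlt') (by
      obtain ⟨x, hx⟩ := rk_mem_multiples (𝓔 := 𝓓) hcα Y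
      obtain ⟨y, hy⟩ := rk_mem_multiples (𝓔 := 𝓓) hcα B
      exact ⟨x - y, by push_cast; rw [← hx, ← hy]; ring⟩)
    linarith
  · exfalso
    have hsub : T ∪ Y ⊆ D := Finset.union_subset hTD hYD
    have h1 := rk_submodular (𝓔 := 𝓓) hα T Y
    have h2 := h (T ∩ Y) (Finset.subset_inter hBT hBY) (Finset.inter_subset_left.trans hTD)
    have h3 := h (T ∪ Y) (hBT.trans Finset.subset_union_left) hsub
    have h4 := hmax (T ∪ Y) ⟨hsub, hBT.trans Finset.subset_union_left, by linarith⟩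
    have h5 : T = T ∪ Y := Finset.eq_of_subset_of_card_le Finset.subset_union_left h4
    exact hbT (h5 ▸ Finset.mem_union_right T hbY)

/-- Isolated points are added to make room for the gadget; they raise the rank and cannot destroy
strength. -/
theorem exists_superset_rk_add (D : Finset V) [Infinite V] (N : ℕ)
    (h𝓓 : ∀ e ∈ 𝓓, e.2.card = ar e.1) :
    ∃ (𝓔 : Set (β × Finset V)) (X : Finset V), D ⊆ X ∧ (∀ e ∈ 𝓔, e.2.card = ar e.1) ∧
      AgreeOn 𝓔 𝓓 D ∧ rk α 𝓔 X = rk α 𝓓 D + N ∧ N ≤ X.card ∧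
      ∀ B ⊆ D, Strong α 𝓓 B D → Strong α 𝓔 B X := by
  classical
  obtain ⟨X, hDX, hX⟩ := Infinite.exists_superset_card_eq D (D.card + N) (by omega)
  set 𝓔 : Set (β × Finset V) := {e | e ∈ 𝓓 ∧ e.2 ⊆ D} with h𝓔
  have hagree : AgreeOn 𝓔 𝓓 D := fun e he => ⟨And.left, fun h => ⟨h, he⟩⟩
  have hrk : ∀ Y : Finset V, rk α 𝓔 Y = rk α 𝓓 (Y ∩ D) + (Y \ D).card := fun Y => by
    have h1 : edgesIn 𝓔 Y = edgesIn 𝓓 (Y ∩ D) := by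
      ext e
      simp only [mem_edgesIn, h𝓔, Set.mem_ofPred_eq, Finset.subset_inter_iff]
      tauto
    rw [rk, rk, h1, ← Finset.card_inter_add_card_sdiff Y D]
    push_cast
    ring
  refine ⟨𝓔, X, hDX, fun e he => h𝓓 e he.1, hagree, ?_, by omega,
    fun B hBD hB Y hBY _ => ?_⟩
  · rw [hrk, Finset.inter_eq_right.2 hDX, Finset.card_sdiff_of_subset hDX, hX]
    simp
  · rw [hrk Y, rk_congr (hagree.mono hBD)]
    have := hB (Y ∩ D) (Finset.subset_inter hBY hBD) Finset.inter_subset_right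
    have h0 : (0 : ℚ) ≤ (Y \ D).card := by positivity
    linarith

/-- The gadget needs two distinct points, whereas the points found for the two strong subsets may
coincide. -/
theorem exists_ne_of_two_le_card {D : Finset V} (hD : 2 ≤ D.card) {x y : V} (hx : x ∈ D)
    (hy : y ∈ D) : ∃ b ∈ D, ∃ b' ∈ D, b ≠ b' ∧ ∀ Y : Finset V, b ∈ Y ∧ b' ∈ Y → x ∈ Y ∧ y ∈ Y := by
  by_cases hxy : x = y
  · obtain ⟨z, hz, hzx⟩ := Finset.exists_mem_ne (by omega : 1 < D.card) x
    exact ⟨x, hx, z, hz, hzx.symm, fun Y h => ⟨h.1, hxy ▸ h.1⟩⟩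
  · exact ⟨x, hx, y, hy, hxy, fun Y h => h⟩

/-- A finite set `D` with strong subsets `B` and `C` of rank at most `t` has an extension of rank
exactly `t` in which `B` and `C` are still strong, if `t` is an integer multiple of `1 / c`. -/
theorem exists_extension_rk_eq [Infinite V] [Nonempty β] (hα : ∀ E, 0 < α E ∧ α E < 1)
    (har : ∀ E, 2 ≤ ar E) {c : ℕ} (hc : c = Finset.univ.lcm fun E => (α E).den) {t : ℚ}
    (ht : ∃ z : ℤ, (c : ℚ) * t = z) (h𝓓 : ∀ e ∈ 𝓓, e.2.card = ar e.1) {B C D : Finset V}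
    (hBD : B ⊆ D) (hCD : C ⊆ D) (hB : Strong α 𝓓 B D) (hC : Strong α 𝓓 C D)
    (hBt : rk α 𝓓 B ≤ t) (hCt : rk α 𝓓 C ≤ t) (htD : t ≤ rk α 𝓓 D) :
    ∃ (𝓔 : Set (β × Finset V)) (X : Finset V), D ⊆ X ∧ (∀ e ∈ 𝓔, e.2.card = ar e.1) ∧
      AgreeOn 𝓔 𝓓 D ∧ Strong α 𝓔 B X ∧ Strong α 𝓔 C X ∧ rk α 𝓔 X = t := by
  classical
  have hα0 : ∀ E, 0 ≤ α E := fun E => (hα E).1.le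
  have hc0 : 0 < c := hc ▸ lcm_den_pos α
  have hc0' : (0 : ℚ) < c := by exact_mod_cast hc0
  have hcα : ∀ E, ∃ z : ℤ, (c : ℚ) * α E = z := hc ▸ lcm_den_mul_eq α
  obtain ⟨N, hN, hdrop⟩ := exists_rk_drop (V := V) hα har hc
  -- Induction on the number `n` of drops by `1 / c` still to be made.
  have key : ∀ (n : ℕ) (𝓓 : Set (β × Finset V)) (D : Finset V), (∀ e ∈ 𝓓, e.2.card = ar e.1) →
      B ⊆ D → C ⊆ D → Strong α 𝓓 B D → Strong α 𝓓 C D → rk α 𝓓 B ≤ t → rk α 𝓓 C ≤ t →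
      N ≤ D.card → rk α 𝓓 D = t + n / c →
      ∃ (𝓔 : Set (β × Finset V)) (X : Finset V), D ⊆ X ∧ (∀ e ∈ 𝓔, e.2.card = ar e.1) ∧
      AgreeOn 𝓔 𝓓 D ∧ Strong α 𝓔 B X ∧ Strong α 𝓔 C X ∧ rk α 𝓔 X = t := by
    intro n
    induction n with
    | zero =>
      intro 𝓓 D h𝓓 hBD hCD hB hC _ _ _ hD
      exact ⟨𝓓, D, subset_rfl, h𝓓, fun e _ => Iff.rfl, hB, hC, by simpa using hD⟩
    | succ n ih =>
      intro 𝓓 D h𝓓 hBD hCD hB hC hBt hCt hND hD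
      have htD : t < rk α 𝓓 D := by
        rw [hD]
        have : (0 : ℚ) < ((n + 1 : ℕ) : ℚ) / c := by positivity
        linarith
      obtain ⟨x, hxD, hx⟩ := hB.exists_mem_forall_le hα0 hc0 hcα hBD (hBt.trans_lt htD)
      obtain ⟨y, hyD, hy⟩ := hC.exists_mem_forall_le hα0 hc0 hcα hCD (hCt.trans_lt htD)
      obtain ⟨b, hbD, b', hbD', hbb, hbxy⟩ := exists_ne_of_two_le_card (hN.trans hND) hxD hyD
      obtain ⟨𝓔, X, hDX, h𝓔, hagree, hrkX, hle, hle'⟩ := hdrop 𝓓 D b b' h𝓓 hbD hbD' hbb hND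
      -- The sets that drop contain `b` and `b'`, hence `a`, and so their traces on `D` exceed the
      -- rank of `A` by at least the `1 / c` that is lost.
      have hstrong : ∀ (A : Finset V) (a : V), A ⊆ D → Strong α 𝓓 A D →
          (∀ Y : Finset V, b ∈ Y ∧ b' ∈ Y → a ∈ Y) → a ∈ D →
          (∀ Y, A ⊆ Y → Y ⊆ D → a ∈ Y → rk α 𝓓 A + 1 / c ≤ rk α 𝓓 Y) →
          Strong α 𝓔 A X := by
        intro A a hAD hA hab haD ha Y hAY hYX
        have hAYD := Finset.subset_inter hAY hAD
        have hYD : Y ∩ D ⊆ D := Finset.inter_subset_right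
        rw [rk_congr (hagree.mono hAD)]
        by_cases hbY : b ∈ Y ∧ b' ∈ Y
        · have h1 := hle Y hYX
          rw [rk_congr (hagree.mono hYD)] at h1
          linarith [ha _ hAYD hYD (Finset.mem_inter.2 ⟨hab Y hbY, haD⟩)]
        · have h1 := hle' Y hYX hbY
          rw [rk_congr (hagree.mono hYD)] at h1
          linarith [hA _ hAYD hYD]
      obtain ⟨𝓕, Z, hXZ, h𝓕, hagree', hBZ, hCZ, hZ⟩ := ih 𝓔 X h𝓔 (hBD.trans hDX) (hCD.trans hDX)
        (hstrong B x hBD hB (fun Y h => (hbxy Y h).1) hxD hx)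
        (hstrong C y hCD hC (fun Y h => (hbxy Y h).2) hyD hy)
        (by rwa [rk_congr (hagree.mono hBD)]) (by rwa [rk_congr (hagree.mono hCD)])
        (hND.trans (Finset.card_le_card hDX)) (by
          rw [hrkX, rk_congr hagree, hD]
          push_cast
          ring)
      exact ⟨𝓕, Z, hDX.trans hXZ, h𝓕, (hagree'.mono hDX).trans hagree, hBZ, hCZ, hZ⟩
  obtain ⟨𝓔, X, hDX, h𝓔, hagree, hrkX, hNX, hstrong⟩ :=
    exists_superset_rk_add (α := α) D N h𝓓
  obtain ⟨n, hn⟩ : ∃ n : ℕ, rk α 𝓔 X = t + n / c := by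
    obtain ⟨z, hz⟩ := ht
    obtain ⟨y, hy⟩ := rk_mem_multiples (𝓔 := 𝓔) hcα X
    have h1 : t ≤ rk α 𝓔 X := by
      rw [hrkX]
      have : (0 : ℚ) ≤ N := by positivity
      linarith
    have h2 : (z : ℚ) ≤ y := by
      rw [← hz, ← hy]
      exact mul_le_mul_of_nonneg_left h1 hc0'.le
    have h3 : z ≤ y := Int.cast_le.1 h2
    obtain ⟨n, hn⟩ := Int.eq_ofNat_of_zero_le (sub_nonneg.2 h3)
    refine ⟨n, ?_⟩
    have h4 : (n : ℚ) = y - z := by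
      have : ((y - z : ℤ) : ℚ) = ((n : ℤ) : ℚ) := by rw [hn]
      push_cast at this
      exact this.symm
    rw [h4, ← hz, ← hy]
    field_simp
    ring
  obtain ⟨𝓕, Z, hXZ, h𝓕, hagree', hBZ, hCZ, hZ⟩ := key n 𝓔 X h𝓔 (hBD.trans hDX)
    (hCD.trans hDX) (hstrong B hBD hB) (hstrong C hCD hC) (by rwa [rk_congr (hagree.mono hBD)])
    (by rwa [rk_congr (hagree.mono hCD)]) hNX hn
  exact ⟨𝓕, Z, hDX.trans hXZ, h𝓕, (hagree'.mono hDX).trans hagree, hBZ, hCZ, hZ⟩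

end Descent

/-! ### Embeddings and free amalgams of edge systems -/

section EdgeEmbeddings

variable {β V W A C : Type*}

/-- The injection `f` preserves and reflects labelled edges. -/
def IsEdgeEmb (𝓔 : Set (β × Finset V)) (𝓕 : Set (β × Finset W)) (f : V ↪ W) : Prop :=
  ∀ (E : β) (s : Finset V), (E, s.map f) ∈ 𝓕 ↔ (E, s) ∈ 𝓔

/-- The image of an edge system under an injection. -/
def mapEdges (f : V ↪ W) (𝓔 : Set (β × Finset V)) : Set (β × Finset W) :=
  {e | ∃ s, (e.1, s) ∈ 𝓔 ∧ s.map f = e.2}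

/-- `A` has the least rank among all finite sets that contain it. -/
def StrongAll [Fintype β] (α : β → ℚ) (𝓔 : Set (β × Finset V)) (A : Finset V) : Prop :=
  ∀ Y, A ⊆ Y → rk α 𝓔 A ≤ rk α 𝓔 Y

theorem isEdgeEmb_mapEdges (f : V ↪ W) (𝓔 : Set (β × Finset V)) :
    IsEdgeEmb 𝓔 (mapEdges f 𝓔) f := by
  intro E s
  constructor
  · rintro ⟨t, ht, hts⟩
    rwa [← Finset.map_injective f hts]
  · exact fun h => ⟨s, h, rfl⟩

theorem card_eq_of_mem_mapEdges {ar : β → ℕ} {f : V ↪ W} {𝓔 : Set (β × Finset V)}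
    (h : ∀ e ∈ 𝓔, e.2.card = ar e.1) : ∀ e ∈ mapEdges f 𝓔, e.2.card = ar e.1 := by
  rintro ⟨E, t⟩ ⟨s, hs, rfl⟩
  simpa using h _ hs

theorem IsEdgeEmb.comp {𝓐 : Set (β × Finset A)} {𝓔 : Set (β × Finset V)} {𝓕 : Set (β × Finset W)}
    {g : V ↪ W} {f : A ↪ V} (hg : IsEdgeEmb 𝓔 𝓕 g) (hf : IsEdgeEmb 𝓐 𝓔 f) :
    IsEdgeEmb 𝓐 𝓕 (f.trans g) := fun E s => by
  rw [← Finset.map_map, hg, hf]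

theorem IsEdgeEmb.congr {𝓔 : Set (β × Finset V)} {𝓕 𝓕' : Set (β × Finset W)} {f : V ↪ W}
    (hf : IsEdgeEmb 𝓔 𝓕 f) {X : Finset W} (h : AgreeOn 𝓕 𝓕' X) (hX : ∀ x, f x ∈ X) :
    IsEdgeEmb 𝓔 𝓕' f := fun E s => by
  rw [← hf, h]
  intro x hx
  obtain ⟨y, -, rfl⟩ := Finset.mem_map.1 hx
  exact hX y

theorem IsEdgeEmb.of_comp {𝓐 : Set (β × Finset A)} {𝓔 : Set (β × Finset V)}
    {𝓕 : Set (β × Finset W)} {g : V ↪ W} {f : A ↪ V} (hg : IsEdgeEmb 𝓔 𝓕 g)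
    (hf : IsEdgeEmb 𝓐 𝓕 (f.trans g)) : IsEdgeEmb 𝓐 𝓔 f := fun E s => by
  rw [← hf, ← Finset.map_map, hg]

variable [Fintype β] {α : β → ℚ}

theorem IsEdgeEmb.rk_map {𝓔 : Set (β × Finset V)} {𝓕 : Set (β × Finset W)} {f : V ↪ W}
    (hf : IsEdgeEmb 𝓔 𝓕 f) (X : Finset V) : rk α 𝓕 (X.map f) = rk α 𝓔 X :=
  BaldwinShi.rk_map f fun E s _ => hf E s

theorem StrongAll.strong {𝓔 : Set (β × Finset V)} {A X : Finset V} (h : StrongAll α 𝓔 A) :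
    Strong α 𝓔 A X := fun Y hY _ => h Y hY

theorem Strong.trans_strongAll (hα : ∀ E, 0 ≤ α E) {𝓔 : Set (β × Finset V)} {A D : Finset V}
    (hAD : A ⊆ D) (h : Strong α 𝓔 A D) (h' : StrongAll α 𝓔 D) : StrongAll α 𝓔 A := by
  classical
  exact fun Y hAY => h.trans hα hAD Finset.subset_union_left
    (h'.strong (X := D ∪ Y)) Y hAY Finset.subset_union_right

theorem IsEdgeEmb.strong_map {𝓔 : Set (β × Finset V)} {𝓕 : Set (β × Finset W)} {f : V ↪ W}
    (hf : IsEdgeEmb 𝓔 𝓕 f) {A X : Finset V} :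
    Strong α 𝓕 (A.map f) (X.map f) ↔ Strong α 𝓔 A X := by
  constructor
  · intro h Y hAY hYX
    have := h (Y.map f) (Finset.map_subset_map.2 hAY) (Finset.map_subset_map.2 hYX)
    rwa [hf.rk_map, hf.rk_map] at this
  · intro h Y hAY hYX
    obtain ⟨Z, hZ, rfl⟩ := Finset.subset_map_iff.1 hYX
    rw [hf.rk_map, hf.rk_map]
    exact h Z (Finset.map_subset_map.1 hAY) hZ

theorem exists_embedding_extending [Finite C] (j : A ↪ C) (g : A ↪ V) [Infinite V]
    (X : Finset V) : ∃ h : C ↪ V, (∀ a, h (j a) = g a) ∧ ∀ c, h c ∈ X → c ∈ Set.range j := by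
  classical
  have : Finite A := Finite.of_injective j j.injective
  have : Infinite ↥((X : Set V) ∪ Set.range g)ᶜ :=
    ((X.finite_toSet.union (Set.finite_range g)).infinite_compl).to_subtype
  have := Fintype.ofFinite C
  let e : C ↪ ↥((X : Set V) ∪ Set.range g)ᶜ :=
    ((Fintype.equivFin C).toEmbedding.trans Fin.valEmbedding).trans (Infinite.natEmbedding _)
  have he : ∀ c, (e c : V) ∉ X ∧ ∀ a, (e c : V) ≠ g a := fun c =>
    ⟨fun hX => (e c).2 (Or.inl hX), fun a ha => (e c).2 (Or.inr ⟨a, ha.symm⟩)⟩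
  have hin : ∀ a, Function.extend j g (fun c => (e c : V)) (j a) = g a := fun a =>
    j.injective.extend_apply _ _ _
  have hout : ∀ c, c ∉ Set.range j → Function.extend j g (fun c => (e c : V)) c = e c :=
    fun c hc => Function.extend_apply' _ _ _ hc
  refine ⟨⟨Function.extend j g fun c => (e c : V), fun c c' hcc => ?_⟩, hin, fun c hc => ?_⟩
  · by_cases h1 : c ∈ Set.range j <;> by_cases h2 : c' ∈ Set.range j
    · obtain ⟨a, rfl⟩ := h1
      obtain ⟨a', rfl⟩ := h2
      rw [hin, hin] at hcc
      rw [g.injective hcc]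
    · obtain ⟨a, rfl⟩ := h1
      rw [hin, hout _ h2] at hcc
      exact absurd hcc.symm ((he c').2 a)
    · obtain ⟨a, rfl⟩ := h2
      rw [hin, hout _ h1] at hcc
      exact absurd hcc ((he c).2 a)
    · rw [hout _ h1, hout _ h2] at hcc
      exact e.injective (Subtype.ext hcc)
  · by_contra h1
    have : (e c : V) ∈ X := hout c h1 ▸ hc
    exact (he c).1 this

/-- Free amalgamation of a finite edge system `𝓒` with an edge system on a finite subset `X` of an
infinite vertex set, over a common part `A`. -/
theorem exists_free_amalgam [Infinite V] [Fintype A] [Fintype C] {ar : β → ℕ}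
    {𝓐 : Set (β × Finset A)} {𝓒 : Set (β × Finset C)} {𝓓 : Set (β × Finset V)}
    (h𝓓 : ∀ e ∈ 𝓓, e.2.card = ar e.1) (h𝓒 : ∀ e ∈ 𝓒, e.2.card = ar e.1) {j : A ↪ C}
    (hj : IsEdgeEmb 𝓐 𝓒 j) {g : A ↪ V} (hg : IsEdgeEmb 𝓐 𝓓 g) {X : Finset V}
    (hgX : ∀ a, g a ∈ X) :
    ∃ (𝓔 : Set (β × Finset V)) (h : C ↪ V) (Z : Finset V), (∀ e ∈ 𝓔, e.2.card = ar e.1) ∧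
      AgreeOn 𝓔 𝓓 X ∧ IsEdgeEmb 𝓒 𝓔 h ∧ (∀ a, h (j a) = g a) ∧
      X ⊆ Z ∧ (∀ c, h c ∈ Z) ∧
      (StrongAll α 𝓒 (Finset.univ.map j) → Strong α 𝓔 X Z) ∧
      (Strong α 𝓓 (Finset.univ.map g) X → Strong α 𝓔 (Finset.univ.map h) Z) ∧
      rk α 𝓔 Z + rk α 𝓐 Finset.univ = rk α 𝓓 X + rk α 𝓒 Finset.univ := by
  classical
  obtain ⟨h, hhj, hhX⟩ := exists_embedding_extending j g X
  set H := Finset.univ.map h with hH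
  have hmemH : ∀ c, h c ∈ H := fun c => Finset.mem_map_of_mem h (Finset.mem_univ c)
  have hjh : j.trans h = g := by
    ext a
    exact hhj a
  have hXH : X ∩ H = Finset.univ.map g := by
    ext x
    simp only [hH, Finset.mem_inter, Finset.mem_map, Finset.mem_univ, true_and]
    constructor
    · rintro ⟨hx, c, rfl⟩
      obtain ⟨a, rfl⟩ := hhX c hx
      exact ⟨a, (hhj a).symm⟩
    · rintro ⟨a, rfl⟩
      exact ⟨hgX a, j a, hhj a⟩
  set 𝓗 := mapEdges h 𝓒 with h𝓗
  have h𝓗H : ∀ e ∈ 𝓗, e.2 ⊆ H := by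
    rintro ⟨E, t⟩ ⟨s, hs, rfl⟩
    exact Finset.map_subset_map.2 (Finset.subset_univ s)
  have hcommon : ∀ e : β × Finset V, e.2 ⊆ X → e.2 ⊆ H → (e ∈ 𝓓 ↔ e ∈ 𝓗) := by
    rintro ⟨E, t⟩ hX ht
    have h1 := Finset.subset_inter hX ht
    rw [hXH] at h1
    obtain ⟨s, -, rfl⟩ := Finset.subset_map_iff.1 h1
    rw [hg, ← hjh, ← Finset.map_map, isEdgeEmb_mapEdges h 𝓒, hj]
  set 𝓔 : Set (β × Finset V) := {e | (e ∈ 𝓓 ∧ e.2 ⊆ X) ∨ e ∈ 𝓗} with h𝓔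
  have hagX : AgreeOn 𝓔 𝓓 X := by
    intro e he
    constructor
    · rintro (h1 | h1)
      · exact h1.1
      · exact (hcommon e he (h𝓗H e h1)).2 h1
    · exact fun h1 => Or.inl ⟨h1, he⟩
  have hagH : AgreeOn 𝓔 𝓗 H := by
    intro e he
    constructor
    · rintro (h1 | h1)
      · exact (hcommon e h1.2 he).1 h1.1
      · exact h1
    · exact fun h1 => Or.inr h1
  have hembH : IsEdgeEmb 𝓒 𝓔 h := (isEdgeEmb_mapEdges h 𝓒).congr hagH.symm hmemH
  -- Every edge of the amalgam lies inside `X` or inside `H`, so the rank is modular here. Both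
  -- strength claims and the rank formula are instances of this.
  have hmod : ∀ Y Y', Y ⊆ X → Y' ⊆ H → X ∩ H ⊆ Y → X ∩ H ⊆ Y' →
      rk α 𝓔 (Y ∪ Y') + rk α 𝓔 (X ∩ H) = rk α 𝓔 Y + rk α 𝓔 Y' := by
    intro Y Y' hYX hYH h1 h2
    have h3 : Y ∩ Y' = X ∩ H :=
      (Finset.inter_subset_inter hYX hYH).antisymm (Finset.subset_inter h1 h2)
    rw [← h3]
    apply rk_modular
    rintro e he heY
    rcases he with he | he
    · left
      intro x hx
      rcases Finset.mem_union.1 (heY hx) with h | h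
      · exact h
      · exact h1 (Finset.mem_inter.2 ⟨he.2 hx, hYH h⟩)
    · right
      intro x hx
      rcases Finset.mem_union.1 (heY hx) with h | h
      · exact h2 (Finset.mem_inter.2 ⟨hYX h, h𝓗H e he hx⟩)
      · exact h
  have hrkg : rk α 𝓔 (X ∩ H) = rk α 𝓐 Finset.univ := by
    rw [hXH, rk_congr (hagX.mono (hXH ▸ Finset.inter_subset_left)), hg.rk_map]
  refine ⟨𝓔, h, X ∪ H, ?_, hagX, hembH, hhj, Finset.subset_union_left,
    fun c => Finset.mem_union_right X (hmemH c), ?_, ?_, ?_⟩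
  · rintro e (he | he)
    · exact h𝓓 e he.1
    · exact card_eq_of_mem_mapEdges h𝓒 e he
  · intro hstr Y hXY hYZ
    have h1 : X ∩ H ⊆ Y ∩ H := Finset.inter_subset_inter_right hXY
    have h2 := hmod X (Y ∩ H) subset_rfl Finset.inter_subset_right Finset.inter_subset_left h1
    have h3 : X ∪ Y ∩ H = Y := by
      rw [Finset.union_inter_distrib_left, Finset.union_eq_right.2 hXY,
        Finset.inter_eq_left.2 hYZ]
    have h4 := hembH.strong_map.2 (hstr.strong (X := Finset.univ)) (Y ∩ H)
      (by rwa [Finset.map_map, hjh, ← hXH]) Finset.inter_subset_right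
    rw [Finset.map_map, hjh, ← hXH] at h4
    rw [h3] at h2
    linarith
  · intro hstr Y hHY hYZ
    have h1 : X ∩ H ⊆ Y ∩ X := fun x hx =>
      Finset.mem_inter.2 ⟨hHY (Finset.mem_inter.1 hx).2, (Finset.mem_inter.1 hx).1⟩
    have h2 := hmod (Y ∩ X) H Finset.inter_subset_right subset_rfl h1 Finset.inter_subset_right
    have h3 : Y ∩ X ∪ H = Y := by
      rw [Finset.union_comm, Finset.union_inter_distrib_left, Finset.union_eq_right.2 hHY,
        Finset.union_comm, Finset.inter_eq_left.2 hYZ]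
    have h4 := hstr.congr (hXH ▸ Finset.inter_subset_left) hagX.symm (Y ∩ X) (hXH ▸ h1)
      Finset.inter_subset_right
    rw [← hXH] at h4
    rw [h3] at h2
    linarith
  · have h1 := hmod X H subset_rfl subset_rfl Finset.inter_subset_left Finset.inter_subset_right
    rw [rk_congr hagX, hrkg, hembH.rk_map] at h1
    exact h1

end EdgeEmbeddings

/-! ### From structures to edge systems -/

section Structures

variable {L : FirstOrder.Language.{u, v}} {M : Type*} {N : Type*} [L.Structure M] [L.Structure N]

variable (L M) in
/-- The labelled edges of a structure: the ranges of the tuples on which some relation holds. -/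
def edges : Set ((Σ n, L.Relations n) × Finset M) :=
  {e | ∃ x : Fin e.1.1 → M, RelMap e.1.2 x ∧ Set.range x = e.2}

theorem IsHypergraph.card_eq (hM : IsHypergraph L M) :
    ∀ e ∈ edges L M, e.2.card = e.1.1 := by
  rintro ⟨E, s⟩ ⟨x, hx, hs⟩
  have h1 : (s : Set M).ncard = E.1 := by
    rw [← hs, ← Set.image_univ, Set.ncard_image_of_injective _ (hM E x hx).1, Set.ncard_univ,
      Nat.card_fin]
  rwa [Set.ncard_coe_finset] at h1

/-- Two repetition-free enumerations of one set differ by a permutation, so by symmetry the edges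
determine the structure. -/
theorem IsHypergraph.relMap_iff (hM : IsHypergraph L M) (E : Σ n, L.Relations n)
    (x : Fin E.1 → M) :
    RelMap E.2 x ↔ ∃ hx : Function.Injective x, (E, Finset.univ.map ⟨x, hx⟩) ∈ edges L M := by
  constructor
  · exact fun h => ⟨(hM E x h).1, x, h, by simp⟩
  · rintro ⟨hx, y, hy, hyx⟩
    have hyx' : Set.range y = Set.range x := by simpa using hyx
    have hyinj := (hM E y hy).1
    let π : Equiv.Perm (Fin E.1) := (Equiv.ofInjective x hx).trans
      ((Equiv.setCongr hyx'.symm).trans (Equiv.ofInjective y hyinj).symm)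
    have : x = y ∘ π := by
      ext i
      have := (Equiv.ofInjective y hyinj).apply_symm_apply
        ((Equiv.setCongr hyx'.symm) (Equiv.ofInjective x hx i))
      exact (congrArg Subtype.val this).symm
    rw [this]
    exact (hM E y hy).2 π

theorem isEdgeEmb (f : M ↪[L] N) : IsEdgeEmb (edges L M) (edges L N) f.toEmbedding := by
  intro E s
  constructor
  · rintro ⟨x, hx, hs⟩
    have h1 : ∀ i, ∃ a ∈ s, f a = x i := fun i => by
      have : x i ∈ (s.map f.toEmbedding : Finset N) := by
        rw [← Finset.mem_coe, ← hs]
        exact Set.mem_range_self i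
      exact Finset.mem_map.1 this
    choose y hys hy using h1
    have hxy : x = f ∘ y := funext fun i => (hy i).symm
    refine ⟨y, ?_, ?_⟩
    · rw [hxy] at hx
      exact (f.map_rel E.2 y).1 hx
    · apply Set.image_injective.2 f.injective
      rw [← Set.range_comp, ← hxy, hs, Finset.coe_map]
      rfl
  · rintro ⟨x, hx, hs⟩
    refine ⟨f ∘ x, (f.map_rel E.2 x).2 hx, ?_⟩
    rw [Set.range_comp, hs, Finset.coe_map]
    rfl

theorem IsHypergraph.of_embedding (f : M ↪[L] N) (hN : IsHypergraph L N) : IsHypergraph L M := by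
  intro E x hx
  obtain ⟨h1, h2⟩ := hN E (f ∘ x) ((f.map_rel E.2 x).2 hx)
  exact ⟨h1.of_comp, fun π => (f.map_rel E.2 _).1 (h2 π)⟩

/-- An injection between hypergraphs that preserves and reflects edges is an embedding. -/
def embeddingOfIsEdgeEmb [L.IsRelational] (hM : IsHypergraph L M) (hN : IsHypergraph L N)
    (f : M ↪ N) (hf : IsEdgeEmb (edges L M) (edges L N) f) : M ↪[L] N where
  toEmbedding := f
  map_fun' {n} F := isEmptyElim F
  map_rel' {n} R x := by
    have h1 := hN.relMap_iff ⟨n, R⟩ (f ∘ x)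
    have h2 := hM.relMap_iff ⟨n, R⟩ x
    dsimp only at h1 h2
    refine h1.trans (Iff.trans ?_ h2.symm)
    constructor
    · rintro ⟨hx, he⟩
      refine ⟨hx.of_comp, (hf ⟨n, R⟩ _).1 ?_⟩
      rwa [Finset.map_map]
    · rintro ⟨hx, he⟩
      refine ⟨f.injective.comp hx, ?_⟩
      have := (hf ⟨n, R⟩ _).2 he
      rwa [Finset.map_map] at this

/-- A set of elements of a structure in a relational language, as a substructure. -/
def substructureOf [L.IsRelational] (X : Set M) : L.Substructure M :=
  ⟨X, fun {_} F => isEmptyElim F⟩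

@[simp] theorem coe_substructureOf [L.IsRelational] (X : Set M) :
    (substructureOf X : L.Substructure M) = X := rfl

theorem exists_finset_eq (S : L.Substructure M) [Finite S] : ∃ X : Finset M, (S : Set M) = X :=
  ⟨(Set.toFinite (S : Set M)).toFinset, by simp⟩

end Structures

/-! ### From edge systems to structures -/

section StructureOn

variable {L : FirstOrder.Language.{u, v}} [L.IsRelational] {V : Type*}
  {𝓔 : Set ((Σ n, L.Relations n) × Finset V)}

/-- The hypergraph that an edge system induces on a set of vertices. -/
@[reducible]
def structureOn (𝓔 : Set ((Σ n, L.Relations n) × Finset V)) (X : Set V) : L.Structure X where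
  funMap F := isEmptyElim F
  RelMap {n} R x := Function.Injective x ∧
    ∃ s, ((⟨n, R⟩, s) : (Σ n, L.Relations n) × Finset V) ∈ 𝓔 ∧
      (s : Set V) = Set.range fun i => (x i : V)

theorem isHypergraph_structureOn (X : Set V) :
    @IsHypergraph L X (structureOn 𝓔 X) := by
  let := structureOn 𝓔 X
  rintro E x ⟨hx, s, hs, hsx⟩
  refine ⟨hx, fun π => ⟨hx.comp π.injective, s, hs, ?_⟩⟩
  rw [hsx]
  exact (π.surjective.range_comp fun i => (x i : V)).symm

/-- The cardinality condition lets each edge be enumerated by an injective tuple of the right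
length, so no edge inside `X` is lost. -/
theorem isEdgeEmb_structureOn (h𝓔 : ∀ e ∈ 𝓔, e.2.card = e.1.1) (X : Set V) :
    IsEdgeEmb (@edges L X (structureOn 𝓔 X)) 𝓔 (Function.Embedding.subtype (· ∈ X)) := by
  let := structureOn 𝓔 X
  intro E s
  constructor
  · intro hs
    have hcard := h𝓔 _ hs
    rw [Finset.card_map] at hcard
    let e := Finset.equivFinOfCardEq hcard
    have hrange : Set.range (fun i => (e.symm i : X)) = s :=
      (e.symm.surjective.range_comp (Subtype.val : s → X)).trans (by simp)
    refine ⟨fun i => e.symm i, ⟨Subtype.val_injective.comp e.symm.injective, _, hs, ?_⟩, hrange⟩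
    rw [Finset.coe_map, ← hrange, ← Set.range_comp]
    rfl
  · rintro ⟨x, ⟨hx, t, ht, htx⟩, hxs⟩
    have : s.map (Function.Embedding.subtype (· ∈ X)) = t := by
      apply Finset.coe_injective
      rw [htx, Finset.coe_map, ← hxs, ← Set.range_comp]
      rfl
    rwa [this]

end StructureOn

/-! ### Translation of rank, strength and the classes -/

section Rank

variable {L : FirstOrder.Language.{u, v}} [Fintype (Σ n, L.Relations n)]
  {α : (Σ n, L.Relations n) → ℚ}

theorem delta_eq_rk (A : Type*) [L.Structure A] [Fintype A] :
    delta α A = rk α (edges L A) Finset.univ := by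
  classical
  have h1 : ∀ E : Σ n, L.Relations n,
      numEdges E A = ((edgesIn (edges L A) Finset.univ).filter fun e => e.1 = E).card := by
    intro E
    rw [numEdges, ← Set.ncard_coe_finset,
      ← Set.InjOn.ncard_image (f := fun e : (Σ n, L.Relations n) × Finset A => (e.2 : Set A))]
    · congr 1
      ext s
      simp only [Set.mem_ofPred_eq, Set.mem_image, Finset.coe_filter, mem_edgesIn,
        Finset.subset_univ, true_and, Prod.exists]
      constructor
      · rintro ⟨x, hx, rfl⟩
        exact ⟨E, (Set.range x).toFinset, ⟨⟨x, hx, by simp⟩, rfl⟩, by simp⟩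
      · rintro ⟨_, t, ⟨⟨x, hx, hxt⟩, rfl⟩, rfl⟩
        exact ⟨x, hx, hxt⟩
    · rintro ⟨E₁, s⟩ h ⟨E₂, t⟩ h' hst
      simp only [Finset.coe_filter, Set.mem_ofPred_eq] at h h'
      obtain rfl : s = t := Finset.coe_injective hst
      rw [h.2, h'.2]
  rw [delta, rk, Nat.card_eq_fintype_card, Finset.card_univ,
    ← Finset.sum_fiberwise (edgesIn (edges L A) Finset.univ) Prod.fst]
  congr 1
  refine Finset.sum_congr rfl fun E _ => ?_
  rw [h1, Finset.sum_congr rfl (g := fun _ => α E), Finset.sum_const, nsmul_eq_mul, mul_comm]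
  intro e he
  rw [(Finset.mem_filter.1 he).2]

variable {M : Type*} {N : Type*} [L.Structure M] [L.Structure N]

theorem delta_eq_rk_map {A : Type*} [L.Structure A] [Fintype A] (f : A ↪[L] M) :
    delta α A = rk α (edges L M) (Finset.univ.map f.toEmbedding) := by
  rw [delta_eq_rk, (isEdgeEmb f).rk_map]

theorem delta_substructure {S : L.Substructure M} {X : Finset M} (h : (S : Set M) = X) :
    delta α S = rk α (edges L M) X := by
  have : Finite S := (h ▸ X.finite_toSet : (S : Set M).Finite)
  have := Fintype.ofFinite S
  rw [delta_eq_rk_map S.subtype]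
  congr 1
  apply Finset.coe_injective
  rw [Finset.coe_map, Finset.coe_univ, Set.image_univ, ← h]
  exact Subtype.range_coe

theorem inKAlpha_iff [L.IsRelational] {A : Type*} [L.Structure A] [Finite A] :
    InKAlpha α A ↔ IsHypergraph L A ∧ ∀ Y : Finset A, 0 ≤ rk α (edges L A) Y := by
  constructor
  · exact fun h => ⟨h.2.1, fun Y => by
      rw [← delta_substructure (coe_substructureOf (L := L) (Y : Set A))]
      exact h.2.2 _⟩
  · refine fun h => ⟨inferInstance, h.1, fun S => ?_⟩
    obtain ⟨X, hX⟩ := exists_finset_eq S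
    rw [delta_substructure hX]
    exact h.2 X

theorem inKAlpha_iff_of_embedding [L.IsRelational] {A : Type*} [L.Structure A] [Fintype A]
    (f : A ↪[L] M) : InKAlpha α A ↔ IsHypergraph L A ∧
      ∀ Y ⊆ Finset.univ.map f.toEmbedding, 0 ≤ rk α (edges L M) Y := by
  rw [inKAlpha_iff]
  refine and_congr_right fun _ => ⟨fun h Y hY => ?_, fun h Y => ?_⟩
  · obtain ⟨Z, -, rfl⟩ := Finset.subset_map_iff.1 hY
    rw [(isEdgeEmb f).rk_map]
    exact h Z
  · rw [← (isEdgeEmb f).rk_map]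
    exact h _ (Finset.map_subset_map.2 (Finset.subset_univ Y))

theorem strongSub_iff [L.IsRelational] {A B : L.Substructure M} {X Y : Finset M}
    (hA : (A : Set M) = X) (hB : (B : Set M) = Y) :
    StrongSub α A B ↔ X ⊆ Y ∧ Strong α (edges L M) X Y := by
  have hAB : A ≤ B ↔ X ⊆ Y := by
    rw [← SetLike.coe_subset_coe, hA, hB, Finset.coe_subset]
  rw [StrongSub, hAB]
  refine and_congr_right fun hXY => ⟨fun h Z hXZ hZY => ?_, fun h S hAS hSB => ?_⟩
  · have h1 := h (substructureOf (Z : Set M)) (by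
      rw [← SetLike.coe_subset_coe, hA]; exact Finset.coe_subset.2 hXZ) (by
      rw [← SetLike.coe_subset_coe, hB]; exact Finset.coe_subset.2 hZY)
    rwa [delta_substructure hA, delta_substructure (coe_substructureOf _)] at h1
  · rw [← SetLike.coe_subset_coe] at hAS hSB
    have : Finite S := (Y.finite_toSet.subset (hB ▸ hSB) : (S : Set M).Finite)
    obtain ⟨Z, hZ⟩ := exists_finset_eq S
    rw [delta_substructure hA, delta_substructure hZ]
    rw [hA, hZ, Finset.coe_subset] at hAS
    rw [hZ, hB, Finset.coe_subset] at hSB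
    exact h Z hAS hSB

theorem strongIn_iff [L.IsRelational] {A : L.Substructure M} {X : Finset M}
    (hA : (A : Set M) = X) : StrongIn α A ↔ StrongAll α (edges L M) X := by
  constructor
  · intro h Y hXY
    have h1 := h (substructureOf (Y : Set M)) Y.finite_toSet (by
      rw [← SetLike.coe_subset_coe, hA]; exact Finset.coe_subset.2 hXY)
    exact ((strongSub_iff hA (coe_substructureOf _)).1 h1).2 Y hXY subset_rfl
  · intro h B hB hAB
    obtain ⟨Y, hY⟩ := exists_finset_eq B
    rw [strongSub_iff hA hY]
    refine ⟨?_, h.strong⟩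
    rw [← SetLike.coe_subset_coe, hA, hY] at hAB
    exact Finset.coe_subset.1 hAB

theorem isStrongEmbedding_iff [L.IsRelational] {A : Type*} [L.Structure A] [Fintype A]
    (f : A ↪[L] M) : IsStrongEmbedding α f ↔
      StrongAll α (edges L M) (Finset.univ.map f.toEmbedding) := by
  apply strongIn_iff
  rw [Hom.range_coe, Finset.coe_map, Finset.coe_univ, Set.image_univ]
  rfl

theorem inKAlpha_congr [L.IsRelational] {A : Type*} {B : Type*} [L.Structure A] [L.Structure B]
    (e : A ≃[L] B) (h : InKAlpha α B) : InKAlpha α A := by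
  have := h.1
  have : Finite A := Finite.of_equiv B e.toEquiv.symm
  have := Fintype.ofFinite A
  rw [inKAlpha_iff] at h
  rw [inKAlpha_iff_of_embedding e.toEmbedding]
  exact ⟨h.1.of_embedding e.toEmbedding, fun Y _ => h.2 Y⟩

theorem delta_congr {A : Type*} {B : Type*} [L.Structure A] [L.Structure B] [Finite B]
    (e : A ≃[L] B) : delta α A = delta α B := by
  have : Finite A := Finite.of_equiv B e.toEquiv.symm
  have := Fintype.ofFinite A
  have := Fintype.ofFinite B
  rw [delta_eq_rk_map e.toEmbedding, delta_eq_rk]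
  congr 1
  ext b
  simp only [Finset.mem_map, Finset.mem_univ, true_and, iff_true]
  exact e.surjective b

theorem inKFix_congr [L.IsRelational] {k : ℕ} {A : Type*} {B : Type*} [L.Structure A]
    [L.Structure B] (e : A ≃[L] B) (h : InKFix α k B) : InKFix α k A := by
  have := h.1.1
  exact ⟨inKAlpha_congr e h.1, (delta_congr e).trans h.2⟩

theorem InKAlphaBar.isHypergraph [L.IsRelational] (h : InKAlphaBar α M) : IsHypergraph L M := by
  intro E x hx
  have h1 := h (substructureOf (Set.range x)) (Set.finite_range x)
  let y : Fin E.1 → (substructureOf (Set.range x) : L.Substructure M) :=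
    fun i => ⟨x i, Set.mem_range_self i⟩
  have h2 := h1.2.1 E y (by
    rw [← (Substructure.subtype _).map_rel]
    exact hx)
  refine ⟨Subtype.val_injective.comp h2.1, fun π => ?_⟩
  have h3 := h2.2 π
  rw [← (Substructure.subtype _).map_rel] at h3
  exact h3

theorem inKAlphaBar_iff [L.IsRelational] :
    InKAlphaBar α M ↔ IsHypergraph L M ∧ ∀ Y : Finset M, 0 ≤ rk α (edges L M) Y := by
  constructor
  · refine fun h => ⟨h.isHypergraph, fun Y => ?_⟩
    have h1 := (h (substructureOf (Y : Set M)) Y.finite_toSet).2.2 ⊤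
    have : Finite (substructureOf (Y : Set M) : L.Substructure M) := Y.finite_toSet
    rwa [delta_congr Substructure.topEquiv, delta_substructure (coe_substructureOf _)] at h1
  · intro h A hA
    have := Fintype.ofFinite A
    rw [inKAlpha_iff_of_embedding A.subtype]
    exact ⟨h.1.of_embedding A.subtype, fun Y _ => h.2 Y⟩

end Rank

/-! ### Strong embeddings into structures built from edge systems -/

section Embeddings

variable {L : FirstOrder.Language.{u, v}} [L.IsRelational] {A B M V : Type*} [L.Structure A]
  [L.Structure B] [L.Structure M] {𝓔 : Set ((Σ n, L.Relations n) × Finset V)}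

theorem exists_embedding_structureOn (hA : IsHypergraph L A) (h𝓔 : ∀ e ∈ 𝓔, e.2.card = e.1.1)
    {h : A ↪ V} (hh : IsEdgeEmb (edges L A) 𝓔 h) {Z : Set V} (hZ : ∀ a, h a ∈ Z) :
    letI := structureOn 𝓔 Z
    ∃ f : A ↪[L] Z, ∀ a, (f a : V) = h a := by
  let := structureOn 𝓔 Z
  let f₀ : A ↪ Z := ⟨fun a => ⟨h a, hZ a⟩, fun a b hab => h.injective (congrArg Subtype.val hab)⟩
  exact ⟨embeddingOfIsEdgeEmb hA (isHypergraph_structureOn Z) f₀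
    ((isEdgeEmb_structureOn h𝓔 Z).of_comp hh), fun a => rfl⟩

/-- Richness speaks only of structures in `Type`; this carries it over to substructures of generics
in any universe. -/
theorem exists_equiv_type [Finite A] (hA : IsHypergraph L A) :
    ∃ (A' : Type) (_ : L.Structure A'), Nonempty (A ≃[L] A') := by
  have := Fintype.ofFinite A
  let h : A ↪ ℕ := (Fintype.equivFin A).toEmbedding.trans Fin.valEmbedding
  let := structureOn (mapEdges h (edges L A)) (Set.range h)
  obtain ⟨f, hf⟩ := exists_embedding_structureOn hA (card_eq_of_mem_mapEdges hA.card_eq)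
    (isEdgeEmb_mapEdges h (edges L A)) (Z := Set.range h) fun a => Set.mem_range_self a
  have hsurj : Function.Surjective f := by
    rintro ⟨_, a, rfl⟩
    exact ⟨a, Subtype.ext (hf a)⟩
  exact ⟨Set.range h, structureOn (mapEdges h (edges L A)) (Set.range h),
    ⟨{ Equiv.ofBijective f ⟨f.injective, hsurj⟩ with
      map_fun' := f.map_fun'
      map_rel' := f.map_rel' }⟩⟩

variable [Fintype (Σ n, L.Relations n)] {α : (Σ n, L.Relations n) → ℚ}

theorem IsStrongEmbedding.comp (hα : ∀ E, 0 ≤ α E) [Finite A] [Finite B] {g : B ↪[L] M}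
    {f : A ↪[L] B} (hg : IsStrongEmbedding α g) (hf : IsStrongEmbedding α f) :
    IsStrongEmbedding α (g.comp f) := by
  have := Fintype.ofFinite A
  have := Fintype.ofFinite B
  rw [isStrongEmbedding_iff] at hg hf ⊢
  have h1 : Finset.univ.map (g.comp f).toEmbedding =
      (Finset.univ.map f.toEmbedding).map g.toEmbedding := by
    rw [Finset.map_map]
    rfl
  rw [h1]
  refine Strong.trans_strongAll hα (Finset.map_subset_map.2 (Finset.subset_univ _)) ?_ hg
  exact (isEdgeEmb g).strong_map.2 hf.strong

theorem isStrongEmbedding_equiv [Finite B] (e : A ≃[L] B) :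
    IsStrongEmbedding α e.toEmbedding := by
  have : Finite A := Finite.of_equiv B e.toEquiv.symm
  have := Fintype.ofFinite A
  have := Fintype.ofFinite B
  rw [isStrongEmbedding_iff]
  intro Y hY
  have : Y = Finset.univ.map e.toEmbedding.toEmbedding := by
    refine Finset.Subset.antisymm (fun b _ => ?_) hY
    obtain ⟨a, rfl⟩ := e.surjective b
    exact Finset.mem_map_of_mem _ (Finset.mem_univ a)
  rw [this]

theorem isStrongEmbedding_structureOn [Fintype A] (h𝓔 : ∀ e ∈ 𝓔, e.2.card = e.1.1) {h : A ↪ V}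
    {Z : Set V} :
    letI := structureOn 𝓔 Z
    ∀ f : A ↪[L] Z, (∀ a, (f a : V) = h a) →
      (IsStrongEmbedding α f ↔ ∀ Y : Finset V, Finset.univ.map h ⊆ Y → (Y : Set V) ⊆ Z →
        rk α 𝓔 (Finset.univ.map h) ≤ rk α 𝓔 Y) := by
  classical
  let := structureOn 𝓔 Z
  intro f hf
  have hfh : f.toEmbedding.trans (Function.Embedding.subtype (· ∈ Z)) = h := by
    ext a
    exact hf a
  have hemb := isEdgeEmb_structureOn h𝓔 Z
  rw [isStrongEmbedding_iff]
  constructor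
  · intro hs Y hY hYZ
    have h1 := hs (Y.subtype (· ∈ Z)) fun z hz => by
      rw [Finset.mem_subtype]
      apply hY
      rw [← hfh, ← Finset.map_map]
      exact Finset.mem_map_of_mem (Function.Embedding.subtype (· ∈ Z)) hz
    rw [← hemb.rk_map, ← hemb.rk_map, Finset.map_map, hfh, Finset.subtype_map,
      Finset.filter_true_of_mem fun x hx => hYZ hx] at h1
    exact h1
  · intro hs Y hY
    rw [← hemb.rk_map, ← hemb.rk_map, Finset.map_map, hfh]
    apply hs
    · rw [← hfh, ← Finset.map_map]
      exact Finset.map_subset_map.2 hY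
    · intro x hx
      obtain ⟨y, -, rfl⟩ := Finset.mem_map.1 (Finset.mem_coe.1 hx)
      exact y.2

theorem isStrongEmbedding_structureOn_finset [Fintype A] (h𝓔 : ∀ e ∈ 𝓔, e.2.card = e.1.1)
    {h : A ↪ V} {Z : Finset V} (hs : Strong α 𝓔 (Finset.univ.map h) Z) :
    letI := structureOn 𝓔 (Z : Set V)
    ∀ f : A ↪[L] (Z : Set V), (∀ a, (f a : V) = h a) → IsStrongEmbedding α f := fun f hf =>
  (isStrongEmbedding_structureOn h𝓔 f hf).2 fun Y hY hYZ => hs Y hY (Finset.coe_subset.1 hYZ)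

theorem inKFix_structureOn (h𝓔 : ∀ e ∈ 𝓔, e.2.card = e.1.1) {k : ℕ} {Z : Finset V}
    (h0 : ∀ Y ⊆ Z, 0 ≤ rk α 𝓔 Y) (hZ : rk α 𝓔 Z = (k : ℚ) / commonDenom α) :
    letI := structureOn 𝓔 (Z : Set V)
    InKFix α k (Z : Set V) := by
  classical
  let := structureOn 𝓔 (Z : Set V)
  have hemb := isEdgeEmb_structureOn h𝓔 (Z : Set V)
  have hsub : ∀ Y : Finset (Z : Set V),
      Y.map (Function.Embedding.subtype (· ∈ (Z : Set V))) ⊆ Z := by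
    intro Y x hx
    obtain ⟨y, -, rfl⟩ := Finset.mem_map.1 hx
    exact y.2
  refine ⟨inKAlpha_iff.2 ⟨isHypergraph_structureOn _, fun Y => ?_⟩, ?_⟩
  · rw [← hemb.rk_map]
    exact h0 _ (hsub Y)
  · rw [delta_eq_rk, ← hemb.rk_map, ← hZ]
    congr 1
    refine (hsub _).antisymm fun x hx => ?_
    exact Finset.mem_map.2 ⟨⟨x, hx⟩, Finset.mem_univ _, rfl⟩

end Embeddings

/-! ### Amalgamation and joint embedding -/

section Fraisse

variable {L : FirstOrder.Language.{u, v}} [Fintype (Σ n, L.Relations n)]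
  {α : (Σ n, L.Relations n) → ℚ}

theorem commonDenom_pos : 0 < commonDenom α := lcm_den_pos α

theorem commonDenom_mul_eq (k : ℕ) : ∃ z : ℤ, (commonDenom α : ℚ) * (k / commonDenom α) = z := by
  have : (commonDenom α : ℚ) ≠ 0 := by exact_mod_cast commonDenom_pos.ne'
  exact ⟨k, by field_simp; simp⟩

theorem rk_map_univ_eq {A V : Type*} [L.Structure A] [Fintype A] {k : ℕ} (hA : InKFix α k A)
    {𝓔 : Set ((Σ n, L.Relations n) × Finset V)} {h : A ↪ V} (hh : IsEdgeEmb (edges L A) 𝓔 h) :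
    rk α 𝓔 (Finset.univ.map h) = k / commonDenom α := by
  rw [hh.rk_map, ← delta_eq_rk, hA.2]

variable [L.IsRelational]

theorem rk_nonneg_of_subset_map {A V : Type*} [L.Structure A] [Fintype A] (hA : InKAlpha α A)
    {𝓔 : Set ((Σ n, L.Relations n) × Finset V)} {h : A ↪ V} (hh : IsEdgeEmb (edges L A) 𝓔 h) :
    ∀ Y ⊆ Finset.univ.map h, 0 ≤ rk α 𝓔 Y := by
  intro Y hY
  obtain ⟨Z, -, rfl⟩ := Finset.subset_map_iff.1 hY
  rw [hh.rk_map]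
  exact (inKAlpha_iff.1 hA).2 Z

theorem amalgamation (hα : ∀ E, 0 < α E ∧ α E < 1) (k : ℕ) (A B C : Type)
    [L.Structure A] [L.Structure B] [L.Structure C]
    (hA : InKFix α k A) (hB : InKFix α k B) (hC : InKFix α k C) (i : A ↪[L] B) (j : A ↪[L] C)
    (hi : IsStrongEmbedding α i) (hj : IsStrongEmbedding α j) :
    ∃ (D : Type) (_ : L.Structure D) (f : B ↪[L] D) (g : C ↪[L] D),
      InKFix α k D ∧ IsStrongEmbedding α f ∧ IsStrongEmbedding α g ∧ f.comp i = g.comp j := by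
  have := hA.1.1
  have := hB.1.1
  have := hC.1.1
  have := Fintype.ofFinite A
  have := Fintype.ofFinite B
  have := Fintype.ofFinite C
  rw [isStrongEmbedding_iff] at hi hj
  have hα0 : ∀ E, 0 ≤ α E := fun E => (hα E).1.le
  let hb : B ↪ ℕ := (Fintype.equivFin B).toEmbedding.trans Fin.valEmbedding
  have hbB := isEdgeEmb_mapEdges hb (edges L B)
  have hgX : ∀ b, hb b ∈ Finset.univ.map hb := fun b => Finset.mem_map_of_mem hb (Finset.mem_univ b)
  obtain ⟨𝓔, h, Z, h𝓔, hagree, hC𝓔, hhj, hXZ, hhZ, hsX, hsH, hrk⟩ :=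
    exists_free_amalgam (α := α) (card_eq_of_mem_mapEdges hB.1.2.1.card_eq) hC.1.2.1.card_eq
      (isEdgeEmb j) (hbB.comp (isEdgeEmb i)) fun a => hgX (i a)
  have hB𝓔 : IsEdgeEmb (edges L B) 𝓔 hb := hbB.congr hagree.symm hgX
  have hXs := hsX hj
  have hHs := hsH (by rw [← Finset.map_map]; exact hbB.strong_map.2 hi.strong)
  -- The free amalgam has rank `k / c + k / c - k / c`, so nothing has to be lowered.
  have hrkZ : rk α 𝓔 Z = k / commonDenom α := by
    rw [← delta_eq_rk, ← delta_eq_rk, hA.2, hC.2, rk_map_univ_eq hB hbB] at hrk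
    linarith
  let := structureOn 𝓔 (Z : Set ℕ)
  obtain ⟨f, hf⟩ := exists_embedding_structureOn hB.1.2.1 h𝓔 hB𝓔 (Z := Z)
    fun b => hXZ (hgX b)
  obtain ⟨g, hg⟩ := exists_embedding_structureOn hC.1.2.1 h𝓔 hC𝓔 (Z := Z) hhZ
  refine ⟨(Z : Set ℕ), this, f, g, inKFix_structureOn h𝓔 (hXs.nonneg hα0 hXZ
    (rk_nonneg_of_subset_map hB.1 hB𝓔)) hrkZ, isStrongEmbedding_structureOn_finset h𝓔 hXs f hf,
    isStrongEmbedding_structureOn_finset h𝓔 hHs g hg, ?_⟩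
  ext a
  change (f (i a) : ℕ) = g (j a)
  rw [hf, hg]
  exact (hhj a).symm

/-- The disjoint union, of rank `2 * k / c`, contains `B` and `C` as strong subsets; the descent
brings it back to `k / c`. -/
theorem jointEmbedding (hL : Nonempty (Σ n, L.Relations n)) (har : ∀ E : Σ n, L.Relations n, 2 ≤ E.1)
    (hα : ∀ E, 0 < α E ∧ α E < 1) (k : ℕ) (B C : Type) [L.Structure B] [L.Structure C]
    (hB : InKFix α k B) (hC : InKFix α k C) :
    ∃ (D : Type) (_ : L.Structure D) (f : B ↪[L] D) (g : C ↪[L] D),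
      InKFix α k D ∧ IsStrongEmbedding α f ∧ IsStrongEmbedding α g := by
  have := hB.1.1
  have := hC.1.1
  have := Fintype.ofFinite B
  have := Fintype.ofFinite C
  have hα0 : ∀ E, 0 ≤ α E := fun E => (hα E).1.le
  let hb : B ↪ ℕ := (Fintype.equivFin B).toEmbedding.trans Fin.valEmbedding
  have hbB := isEdgeEmb_mapEdges hb (edges L B)
  have hgX : ∀ b, hb b ∈ Finset.univ.map hb := fun b => Finset.mem_map_of_mem hb (Finset.mem_univ b)
  have h𝓑 := card_eq_of_mem_mapEdges (f := hb) (ar := Sigma.fst) hB.1.2.1.card_eq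
  have hempty : ∀ {W : Type} {𝓕 : Set ((Σ n, L.Relations n) × Finset W)}
      (_ : ∀ e ∈ 𝓕, e.2.card = e.1.1) (j : Empty ↪ W), IsEdgeEmb ∅ 𝓕 j := by
    intro W 𝓕 h𝓕 j E s
    simp only [Set.mem_empty_iff_false, iff_false]
    intro h
    have h1 := h𝓕 _ h
    have h2 := har E
    rw [Finset.card_map, Finset.eq_empty_of_isEmpty s, Finset.card_empty] at h1
    dsimp only at h1
    omega
  obtain ⟨𝓔, h, Z, h𝓔, hagree, hC𝓔, -, hXZ, hhZ, hsX, hsH, hrk⟩ :=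
    exists_free_amalgam (α := α) h𝓑 hC.1.2.1.card_eq
      (hempty hC.1.2.1.card_eq Function.Embedding.ofIsEmpty)
      (hempty h𝓑 Function.Embedding.ofIsEmpty) (X := Finset.univ.map hb) fun a => a.elim
  have hB𝓔 : IsEdgeEmb (edges L B) 𝓔 hb := hbB.congr hagree.symm hgX
  have hpos : ∀ {W : Type} {𝓕 : Set ((Σ n, L.Relations n) × Finset W)}
      (_ : ∀ e ∈ 𝓕, e.2.card = e.1.1), rk α 𝓕 ∅ = 0 := fun h𝓕 =>
    rk_empty fun e he => by have := h𝓕 e he; have := har e.1; omega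
  have hXs := hsX fun Y _ => by
    rw [Finset.univ_eq_empty, Finset.map_empty, hpos hC.1.2.1.card_eq]
    exact (inKAlpha_iff.1 hC.1).2 Y
  have hHs := hsH fun Y _ hY => by
    rw [Finset.univ_eq_empty, Finset.map_empty, hpos h𝓑]
    exact rk_nonneg_of_subset_map hB.1 hbB Y hY
  have hrkX := rk_map_univ_eq hB hB𝓔
  have hrkH := rk_map_univ_eq hC hC𝓔
  have hHZ : Finset.univ.map h ⊆ Z := fun x hx => by
    obtain ⟨c, -, rfl⟩ := Finset.mem_map.1 hx
    exact hhZ c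
  obtain ⟨𝓕, Y, hZY, h𝓕, hagree', hXY, hHY, hY⟩ := exists_extension_rk_eq hα har
    (c := commonDenom α) rfl (commonDenom_mul_eq k) h𝓔 hXZ hHZ hXs hHs hrkX.le hrkH.le
    (hrkX ▸ hXs Z hXZ subset_rfl)
  have hB𝓕 : IsEdgeEmb (edges L B) 𝓕 hb := hB𝓔.congr hagree'.symm fun b => hXZ (hgX b)
  have hC𝓕 : IsEdgeEmb (edges L C) 𝓕 h := hC𝓔.congr hagree'.symm hhZ
  let := structureOn 𝓕 (Y : Set ℕ)
  obtain ⟨f, hf⟩ := exists_embedding_structureOn hB.1.2.1 h𝓕 hB𝓕 (Z := Y)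
    fun b => hZY (hXZ (hgX b))
  obtain ⟨g, hg⟩ := exists_embedding_structureOn hC.1.2.1 h𝓕 hC𝓕 (Z := Y) fun c => hZY (hhZ c)
  exact ⟨(Y : Set ℕ), this, f, g, inKFix_structureOn h𝓕 (hXY.nonneg hα0 (hXZ.trans hZY)
    (rk_nonneg_of_subset_map hB.1 hB𝓕)) hY, isStrongEmbedding_structureOn_finset h𝓕 hXY f hf,
    isStrongEmbedding_structureOn_finset h𝓕 hHY g hg⟩

end Fraisse

/-! ### Meaning of the axioms -/

section Diagram

variable {L : FirstOrder.Language.{u, v}} [L.IsRelational] [Fintype (Σ n, L.Relations n)]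
  {M : Type w'} [L.Structure M]

theorem realize_diagram {A : Type w} [Finite A] [L.Structure A] {x : A → M} :
    (diagram (L := L) A).Realize x ↔ ∃ f : A ↪[L] M, ⇑f = x := by
  classical
  have h1 : (diagram (L := L) A).Realize x ↔ Function.Injective x ∧
      ∀ (E : Σ n, L.Relations n) (y : Fin E.1 → A), RelMap E.2 (x ∘ y) ↔ RelMap E.2 y := by
    rw [diagram, Formula.realize_inf, Formula.realize_iInf, Formula.realize_iInf]
    refine and_congr ?_ (forall_congr' fun E => ?_)
    · simp only [Formula.realize_not, Formula.realize_equal, Term.realize_var, Subtype.forall,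
        Prod.forall, Function.Injective]
      exact forall₂_congr fun a b => not_imp_not
    · rw [Formula.realize_iInf]
      refine forall_congr' fun y => ?_
      split_ifs with h
      · simp only [Formula.realize_rel, Term.realize_var, h, iff_true]
        rfl
      · simp only [Formula.realize_not, Formula.realize_rel, Term.realize_var, h, iff_false]
        rfl
  rw [h1]
  constructor
  · rintro ⟨hx, hr⟩
    exact ⟨{ toFun := x
             inj' := hx
             map_fun' := fun {n} F => isEmptyElim F
             map_rel' := fun {n} R y => hr ⟨n, R⟩ y }, rfl⟩
  · rintro ⟨f, rfl⟩
    exact ⟨f.injective, fun E y => f.map_rel E.2 y⟩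

theorem realize_omitSentence {A : Type w} [Finite A] [L.Structure A] :
    M ⊨ omitSentence (L := L) A ↔ IsEmpty (A ↪[L] M) := by
  rw [omitSentence, Sentence.Realize, Formula.realize_not, Formula.realize_iExs, ← not_nonempty_iff]
  refine not_congr ⟨?_, ?_⟩
  · rintro ⟨x, hx⟩
    rw [Formula.realize_relabel, realize_diagram] at hx
    exact ⟨hx.choose⟩
  · rintro ⟨f⟩
    refine ⟨f, ?_⟩
    rw [Formula.realize_relabel, realize_diagram]
    exact ⟨f, rfl⟩

theorem realize_extensionSentence {B : Type w} [Finite B] [L.Structure B] {A : L.Substructure B}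
    (h : ∀ f : A ↪[L] M, ∃ g : B ↪[L] M, g.comp A.subtype = f) :
    M ⊨ extensionSentence A := by
  classical
  rw [extensionSentence, Sentence.Realize, Formula.realize_iAlls]
  intro x
  rw [Formula.realize_relabel, Formula.realize_imp, realize_diagram]
  rintro ⟨f, hf⟩
  obtain ⟨g, rfl⟩ := h f
  rw [Formula.realize_iExs]
  refine ⟨fun b => g b, ?_⟩
  rw [Formula.realize_relabel, realize_diagram]
  refine ⟨g, funext fun b => ?_⟩
  simp only [Function.comp_apply]
  split_ifs with hb
  · exact congrFun hf ⟨b, hb⟩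
  · rfl

end Diagram

/-! ### Properties and uniqueness of generics -/

section Generic

variable {L : FirstOrder.Language.{u, v}} [Fintype (Σ n, L.Relations n)]
  {α : (Σ n, L.Relations n) → ℚ} {k : ℕ} {M : Type w} [L.Structure M]

theorem isStrongEmbedding_iff_strongIn {A : Type*} [L.Structure A] {S : L.Substructure M}
    {f : A ↪[L] M} (h : f.toHom.range = S) : IsStrongEmbedding α f ↔ StrongIn α S := by
  rw [IsStrongEmbedding, h]

theorem StrongIn.delta_le {A B : L.Substructure M} (hA : StrongIn α A) [Finite B] (hAB : A ≤ B) :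
    delta α A ≤ delta α B :=
  (hA B inferInstance hAB).2 B hAB le_rfl

variable [L.IsRelational]

/-- Richness for structures in arbitrary universes. -/
theorem IsGenericFix.exists_strong_extension (hα : ∀ E, 0 ≤ α E) (hM : IsGenericFix α k M)
    {A B : Type*} [L.Structure A] [L.Structure B] (hA : InKFix α k A) (hB : InKFix α k B)
    (i : A ↪[L] B) (f : A ↪[L] M) (hi : IsStrongEmbedding α i) (hf : IsStrongEmbedding α f) :
    ∃ g : B ↪[L] M, IsStrongEmbedding α g ∧ g.comp i = f := by
  have := hA.1.1
  have := hB.1.1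
  obtain ⟨A', _, ⟨a⟩⟩ := exists_equiv_type hA.1.2.1
  obtain ⟨B', _, ⟨b⟩⟩ := exists_equiv_type hB.1.2.1
  have : Finite A' := Finite.of_equiv A a.toEquiv
  have : Finite B' := Finite.of_equiv B b.toEquiv
  obtain ⟨g, hg, hgi⟩ := hM.rich A' B' (inKFix_congr a.symm hA) (inKFix_congr b.symm hB)
    ((b.toEmbedding.comp i).comp a.symm.toEmbedding) (f.comp a.symm.toEmbedding)
    (((isStrongEmbedding_equiv b).comp hα hi).comp hα (isStrongEmbedding_equiv a.symm))
    (hf.comp hα (isStrongEmbedding_equiv a.symm))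
  refine ⟨g.comp b.toEmbedding, hg.comp hα (isStrongEmbedding_equiv b), ?_⟩
  ext x
  have := DFunLike.congr_fun hgi (a x)
  simpa using this

/-- Neither the rank of `A` nor strength of its image is prescribed, so richness does not apply
directly. The image is enclosed in a strong `C` from the class. In the free amalgam of `C` and `B`
over `A` only `C` has to be strong, and this follows from strength of `A` in `B`. -/
theorem IsGenericFix.exists_extension (hL : Nonempty (Σ n, L.Relations n))
    (har : ∀ E : Σ n, L.Relations n, 2 ≤ E.1) (hα : ∀ E, 0 < α E ∧ α E < 1)
    (hM : IsGenericFix α k M) {A B : Type*} [L.Structure A] [L.Structure B] [Finite A]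
    (hB : InKAlpha α B) (i : A ↪[L] B) (f : A ↪[L] M) (hi : IsStrongEmbedding α i) :
    ∃ g : B ↪[L] M, g.comp i = f := by
  have hα0 : ∀ E, 0 ≤ α E := fun E => (hα E).1.le
  obtain ⟨C, hfC, hC, hCM⟩ := hM.cofinal f.toHom.range (Set.finite_range f)
  have := hB.1
  have := hC.1.1
  have := Fintype.ofFinite A
  have := Fintype.ofFinite B
  have := Fintype.ofFinite C
  rw [isStrongEmbedding_iff] at hi
  let f' : A ↪[L] C := f.codRestrict C fun a => hfC (f.toHom.mem_range_self a)
  let hc : C ↪ ℕ := (Fintype.equivFin C).toEmbedding.trans Fin.valEmbedding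
  have hcC := isEdgeEmb_mapEdges hc (edges L C)
  have hgX : ∀ c, hc c ∈ Finset.univ.map hc := fun c => Finset.mem_map_of_mem hc (Finset.mem_univ c)
  obtain ⟨𝓔, h, Z, h𝓔, hagree, hB𝓔, hhi, hXZ, hhZ, hsX, -, -⟩ :=
    exists_free_amalgam (α := α) (card_eq_of_mem_mapEdges hC.1.2.1.card_eq) hB.2.1.card_eq
      (isEdgeEmb i) (hcC.comp (isEdgeEmb f')) fun a => hgX (f' a)
  have hC𝓔 : IsEdgeEmb (edges L C) 𝓔 hc := hcC.congr hagree.symm hgX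
  have hXs := hsX hi
  have hrkX := rk_map_univ_eq hC hC𝓔
  -- There is only one subset to protect, so it is used in both roles.
  obtain ⟨𝓕, Y, hZY, h𝓕, hagree', hXY, -, hY⟩ := exists_extension_rk_eq hα har
    (c := commonDenom α) rfl (commonDenom_mul_eq k) h𝓔 hXZ hXZ hXs hXs hrkX.le hrkX.le
    (hrkX ▸ hXs Z hXZ subset_rfl)
  have hC𝓕 : IsEdgeEmb (edges L C) 𝓕 hc := hC𝓔.congr hagree'.symm fun c => hXZ (hgX c)
  have hB𝓕 : IsEdgeEmb (edges L B) 𝓕 h := hB𝓔.congr hagree'.symm hhZ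
  let := structureOn 𝓕 (Y : Set ℕ)
  obtain ⟨e, he⟩ := exists_embedding_structureOn hC.1.2.1 h𝓕 hC𝓕 (Z := Y)
    fun c => hZY (hXZ (hgX c))
  obtain ⟨e', he'⟩ := exists_embedding_structureOn hB.2.1 h𝓕 hB𝓕 (Z := Y) fun b => hZY (hhZ b)
  obtain ⟨g, -, hg⟩ := hM.exists_strong_extension hα0 hC
    (inKFix_structureOn h𝓕 (hXY.nonneg hα0 (hXZ.trans hZY) (rk_nonneg_of_subset_map hC.1 hC𝓕)) hY)
    e C.subtype (isStrongEmbedding_structureOn_finset h𝓕 hXY e he)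
    ((isStrongEmbedding_iff_strongIn C.range_subtype).2 hCM)
  refine ⟨g.comp e', ?_⟩
  ext a
  have h1 : e' (i a) = e (f' a) := by
    apply Subtype.ext
    rw [he, he']
    exact hhi a
  have h2 := DFunLike.congr_fun hg (f' a)
  rw [Embedding.comp_apply] at h2
  rw [Embedding.comp_apply, Embedding.comp_apply, h1, h2]
  rfl

theorem IsGenericFix.models_theoryS (hL : Nonempty (Σ n, L.Relations n))
    (har : ∀ E : Σ n, L.Relations n, 2 ≤ E.1) (hα : ∀ E, 0 < α E ∧ α E < 1)
    (hM : IsGenericFix α k M) : M ⊨ theoryS α := by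
  rw [Theory.model_iff]
  rintro φ (⟨n, _, hn, rfl⟩ | ⟨n, _, A, hn, hA, rfl⟩)
  · rw [realize_omitSentence]
    refine ⟨fun f => hn ?_⟩
    have h1 := inKAlphaBar_iff.1 hM.mem
    exact (inKAlpha_iff_of_embedding f).2 ⟨h1.1.of_embedding f, fun Y _ => h1.2 Y⟩
  · refine realize_extensionSentence fun f => hM.exists_extension hL har hα hn A.subtype f ?_
    rwa [isStrongEmbedding_iff_strongIn A.range_subtype]

/-- A finite strong `B` lies in a member `C` of the class, and strength bounds its rank by that of
`C`. The value is attained since the class has a strong member inside `M`. -/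
theorem IsGenericFix.dim_eq (har : ∀ E : Σ n, L.Relations n, 2 ≤ E.1) (hM : IsGenericFix α k M) :
    dim α M = (((k : ℚ) / (commonDenom α : ℚ) : ℚ) : WithTop ℚ) := by
  have hbot : ((⊥ : L.Substructure M) : Set M) = (∅ : Finset M) := by
    rw [Finset.coe_empty, ← Substructure.closure_empty, Substructure.closure_eq_of_isRelational]
  have h0 := inKAlphaBar_iff.1 hM.mem
  have hrk0 : rk α (edges L M) ∅ = 0 := rk_empty fun e he => by
    have h1 := h0.1.card_eq e he
    have h2 := har e.1
    omega
  have hδ0 : delta α (⊥ : L.Substructure M) = 0 := by rw [delta_substructure hbot, hrk0]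
  have hg : IsGreatest {q : ℚ | ∃ B : L.Substructure M, Finite B ∧
      StrongSub α ⊥ B ∧ StrongIn α B ∧ q = delta α B - delta α (⊥ : L.Substructure M)}
      ((k : ℚ) / (commonDenom α : ℚ)) := by
    constructor
    · obtain ⟨B, -, hB, hBM⟩ := hM.cofinal ⊥ (hbot ▸ Finset.finite_toSet ∅ :
        ((⊥ : L.Substructure M) : Set M).Finite)
      have := hB.1.1
      refine ⟨B, hB.1.1, ?_, hBM, by rw [hδ0, hB.2, sub_zero]⟩
      obtain ⟨Y, hY⟩ := exists_finset_eq B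
      rw [strongSub_iff hbot hY]
      refine ⟨Finset.empty_subset Y, fun Z _ _ => ?_⟩
      rw [hrk0]
      exact h0.2 Z
    · rintro _ ⟨B, hB, -, hBM, rfl⟩
      obtain ⟨C, hBC, hC, -⟩ := hM.cofinal B hB
      have := hC.1.1
      rw [hδ0, sub_zero, ← hC.2]
      exact hBM.delta_le hBC
  have hex : ∃ q, IsGreatest {q : ℚ | ∃ B : L.Substructure M, Finite B ∧
      StrongSub α ⊥ B ∧ StrongIn α B ∧ q = delta α B - delta α (⊥ : L.Substructure M)} q := ⟨_, hg⟩
  rw [dim, dimOver, dif_pos hex, hex.choose_spec.unique hg]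

variable {N : Type w'} [L.Structure N]

/-- Isomorphisms between finite strong substructures of rank `k / c`. -/
structure IsStrongIso (α : (Σ n, L.Relations n) → ℚ) (k : ℕ) (p : M ≃ₚ[L] N) : Prop where
  inKFix : InKFix α k p.dom
  dom : StrongIn α p.dom
  cod : StrongIn α p.cod

theorem IsStrongIso.symm {p : M ≃ₚ[L] N} (h : IsStrongIso α k p) : IsStrongIso α k p.symm :=
  ⟨inKFix_congr p.toEquiv.symm h.inKFix, h.cod, h.dom⟩

theorem IsStrongIso.exists_mem_dom (hα : ∀ E, 0 ≤ α E) (hM : IsGenericFix α k M)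
    (hN : IsGenericFix α k N) {p : M ≃ₚ[L] N} (h : IsStrongIso α k p) (m : M) :
    ∃ q, IsStrongIso α k q ∧ m ∈ q.dom ∧ p ≤ q := by
  have := h.inKFix.1.1
  have hfin : Finite (substructureOf (insert m (p.dom : Set M)) : L.Substructure M) :=
    (Set.toFinite (p.dom : Set M)).insert m
  obtain ⟨B, hpB, hB, hBM⟩ := hM.cofinal _ hfin
  have hdB : p.dom ≤ B := fun x hx => hpB (Set.mem_insert_of_mem m hx)
  have := hB.1.1
  have hstr : IsStrongEmbedding α (Substructure.inclusion hdB) := by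
    have := Fintype.ofFinite p.dom
    rw [isStrongEmbedding_iff]
    obtain ⟨X, hX⟩ := exists_finset_eq p.dom
    have h1 := (strongIn_iff hX).1 h.dom
    have h2 : (Finset.univ.map (Substructure.inclusion hdB).toEmbedding).map
        B.subtype.toEmbedding = X := by
      apply Finset.coe_injective
      rw [Finset.map_map, Finset.coe_map, Finset.coe_univ, Set.image_univ, ← hX]
      exact Subtype.range_coe
    intro Y hY
    rw [← (isEdgeEmb B.subtype).rk_map, ← (isEdgeEmb B.subtype).rk_map, h2]
    exact h1 _ (h2 ▸ Finset.map_subset_map.2 hY)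
  have hpN : IsStrongEmbedding α p.toEmbedding := by
    refine (isStrongEmbedding_iff_strongIn ?_).2 h.cod
    ext x
    rw [Hom.mem_range]
    constructor
    · rintro ⟨y, rfl⟩
      exact (p.toEquiv y).2
    · intro hx
      exact ⟨p.toEquiv.symm ⟨x, hx⟩, by simp⟩
  obtain ⟨g, hg, hgp⟩ := hN.exists_strong_extension hα h.inKFix hB
    (Substructure.inclusion hdB) p.toEmbedding hstr hpN
  exact ⟨⟨B, g.toHom.range, g.equivRange⟩, ⟨hB, hBM, hg⟩, hpB (Set.mem_insert m _),
    hdB, hgp⟩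

theorem IsStrongIso.exists_mem_cod (hα : ∀ E, 0 ≤ α E) (hM : IsGenericFix α k M)
    (hN : IsGenericFix α k N) {p : M ≃ₚ[L] N} (h : IsStrongIso α k p) (n : N) :
    ∃ q, IsStrongIso α k q ∧ n ∈ q.cod ∧ p ≤ q := by
  obtain ⟨q, hq, hnq, hpq⟩ := h.symm.exists_mem_dom hα hN hM n
  exact ⟨q.symm, hq.symm, hnq, PartialEquiv.symm_le_iff.1 hpq⟩

/-- For `k > 0` the empty map is not available, as the empty structure has rank 0. The start is
instead a joint extension of a member inside `M` and one inside `N`, realized in `N` by richness. -/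
theorem exists_isStrongIso (hL : Nonempty (Σ n, L.Relations n))
    (har : ∀ E : Σ n, L.Relations n, 2 ≤ E.1) (hα : ∀ E, 0 < α E ∧ α E < 1)
    (hM : IsGenericFix α k M) (hN : IsGenericFix α k N) :
    ∃ p : M ≃ₚ[L] N, IsStrongIso α k p := by
  have hα0 : ∀ E, 0 ≤ α E := fun E => (hα E).1.le
  obtain ⟨B, -, hB, hBM⟩ := hM.cofinal (substructureOf ∅) Set.finite_empty
  obtain ⟨C, -, hC, hCN⟩ := hN.cofinal (substructureOf ∅) Set.finite_empty
  have := hB.1.1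
  have := hC.1.1
  obtain ⟨B', _, ⟨b⟩⟩ := exists_equiv_type hB.1.2.1
  obtain ⟨C', _, ⟨c⟩⟩ := exists_equiv_type hC.1.2.1
  have : Finite B' := Finite.of_equiv B b.toEquiv
  have : Finite C' := Finite.of_equiv C c.toEquiv
  obtain ⟨D, _, f, g, hD, hf, hg⟩ := jointEmbedding hL har hα k B' C' (inKFix_congr b.symm hB)
    (inKFix_congr c.symm hC)
  have := hD.1.1
  obtain ⟨h, hh, -⟩ := hN.exists_strong_extension hα0 hC hD (g.comp c.toEmbedding) C.subtype
    (hg.comp hα0 (isStrongEmbedding_equiv c)) ((isStrongEmbedding_iff_strongIn C.range_subtype).2 hCN)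
  let e : B ↪[L] N := (h.comp f).comp b.toEmbedding
  have he : IsStrongEmbedding α e := (hh.comp hα0 hf).comp hα0 (isStrongEmbedding_equiv b)
  exact ⟨⟨B, e.toHom.range, e.equivRange⟩, hB, hBM, he⟩

theorem IsGenericFix.nonempty_equiv (hL : Nonempty (Σ n, L.Relations n))
    (har : ∀ E : Σ n, L.Relations n, 2 ≤ E.1) (hα : ∀ E, 0 < α E ∧ α E < 1)
    (hM : IsGenericFix α k M) (hN : IsGenericFix α k N) : Nonempty (M ≃[L] N) := by
  have hα0 : ∀ E, 0 ≤ α E := fun E => (hα E).1.le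
  obtain ⟨p, hp⟩ := exists_isStrongIso hL har hα hM hN
  have := hM.countable
  have := hN.countable
  have := Encodable.ofCountable M
  have := Encodable.ofCountable N
  let P := {p : M ≃ₚ[L] N // IsStrongIso α k p}
  -- Back-and-forth: one cofinal requirement for each element of either structure.
  let D : M ⊕ N → Order.Cofinal P := Sum.elim
    (fun m => ⟨{q | m ∈ q.1.dom}, fun q => by
      obtain ⟨r, hr, hm, hqr⟩ := q.2.exists_mem_dom hα0 hM hN m
      exact ⟨⟨r, hr⟩, hm, hqr⟩⟩)
    (fun n => ⟨{q | n ∈ q.1.cod}, fun q => by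
      obtain ⟨r, hr, hn, hqr⟩ := q.2.exists_mem_cod hα0 hM hN n
      exact ⟨⟨r, hr⟩, hn, hqr⟩⟩)
  let S : ℕ →o M ≃ₚ[L] N :=
    ⟨Subtype.val ∘ Order.sequenceOfCofinals (⟨p, hp⟩ : P) D,
      (Subtype.mono_coe _).comp (Order.sequenceOfCofinals.monotone _ _)⟩
  let F := DirectLimit.partialEquivLimit S
  have hdom : F.dom = ⊤ := by
    refine top_le_iff.1 fun m _ => ?_
    have h1 := Order.sequenceOfCofinals.encode_mem (⟨p, hp⟩ : P) D (Sum.inl m)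
    exact PartialEquiv.dom_le_dom
      (DirectLimit.le_partialEquivLimit S (Encodable.encode (Sum.inl m : M ⊕ N) + 1)) h1
  have hcod : F.cod = ⊤ := by
    refine top_le_iff.1 fun n _ => ?_
    have h1 := Order.sequenceOfCofinals.encode_mem (⟨p, hp⟩ : P) D (Sum.inr n)
    exact PartialEquiv.cod_le_cod
      (DirectLimit.le_partialEquivLimit S (Encodable.encode (Sum.inr n : M ⊕ N) + 1)) h1
  exact ⟨PartialEquiv.toEquivOfEqTop hdom hcod⟩

end Generic

/-! ### A chain of finite systems that solves every task -/

section Existence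

variable {β : Type*} [Fintype β]

/-- A finite edge system on natural numbers whose subsets have nonnegative rank and that has rank
`t` itself. -/
structure FiniteSystem (α : β → ℚ) (ar : β → ℕ) (t : ℚ) where
  edges : Set (β × Finset ℕ)
  verts : Finset ℕ
  card_eq : ∀ e ∈ edges, e.2.card = ar e.1
  supp : ∀ e ∈ edges, e.2 ⊆ verts
  nonneg : ∀ Y ⊆ verts, 0 ≤ rk α edges Y
  rk_eq : rk α edges verts = t

namespace FiniteSystem

variable {α : β → ℚ} {ar : β → ℕ} {t : ℚ} (p q r : FiniteSystem α ar t)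

/-- `q` is a strong extension of `p`. -/
structure Le : Prop where
  subset : p.verts ⊆ q.verts
  agree : AgreeOn q.edges p.edges p.verts
  strong : Strong α q.edges p.verts q.verts

variable {p q r}

theorem Le.refl : Le p p :=
  ⟨subset_rfl, fun _ _ => Iff.rfl, fun Y h h' => by rw [h.antisymm h']⟩

theorem Le.trans (hα : ∀ E, 0 ≤ α E) (h : Le p q) (h' : Le q r) : Le p r :=
  ⟨h.subset.trans h'.subset, (h'.agree.mono h.subset).trans h.agree,
    (h.strong.congr h.subset h'.agree.symm).trans hα h.subset h'.subset h'.strong⟩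

theorem exists_of_edges {𝓔 : Set (β × Finset ℕ)} {X : Finset ℕ}
    (h𝓔 : ∀ e ∈ 𝓔, e.2.card = ar e.1) (h0 : ∀ Y ⊆ X, 0 ≤ rk α 𝓔 Y) (ht : rk α 𝓔 X = t) :
    ∃ p : FiniteSystem α ar t, p.verts = X ∧ AgreeOn p.edges 𝓔 X := by
  have h : AgreeOn {e | e ∈ 𝓔 ∧ e.2 ⊆ X} 𝓔 X := fun e he => ⟨And.left, fun h => ⟨h, he⟩⟩
  exact ⟨⟨{e | e ∈ 𝓔 ∧ e.2 ⊆ X}, X, fun e he => h𝓔 e he.1, fun e he => he.2,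
    fun Y hY => by rw [rk_congr (h.mono hY)]; exact h0 Y hY, by rw [rk_congr h, ht]⟩, rfl, h⟩

/-- A finite edge system together with a partial injection of its vertices to be extended. -/
abbrev Task (β : Type*) : Type _ :=
  Σ n : ℕ, Finset (β × Finset (Fin n)) × Finset (Fin n) × (Fin n → ℕ)

/-- The partial map in the task `T` extends to a strong embedding into `p`. -/
def Solves (T : Task β) (p : FiniteSystem α ar t) : Prop :=
  ∃ h : Fin T.1 ↪ ℕ, IsEdgeEmb (T.2.1 : Set (β × Finset (Fin T.1))) p.edges h ∧
    (∀ x ∈ T.2.2.1, h x = T.2.2.2 x) ∧ (∀ x, h x ∈ p.verts) ∧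
    Strong α p.edges (Finset.univ.map h) p.verts

theorem exists_chain (hα : ∀ E, 0 ≤ α E) (p₀ : FiniteSystem α ar t) :
    ∃ p : ℕ → FiniteSystem α ar t, (∀ m n, m ≤ n → Le (p m) (p n)) ∧
      ∀ (T : Task β) (N : ℕ), ∃ m, N ≤ m ∧ ((∃ q, Le (p m) q ∧ Solves T q) → Solves T (p (m + 1))) := by
  have hstep : ∀ (T : Task β) (p : FiniteSystem α ar t), ∃ q, Le p q ∧
      ((∃ r, Le p r ∧ Solves T r) → Solves T q) := by
    intro T p
    by_cases h : ∃ r, Le p r ∧ Solves T r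
    · obtain ⟨r, hr, hT⟩ := h
      exact ⟨r, hr, fun _ => hT⟩
    · exact ⟨p, Le.refl, fun h' => absurd h' h⟩
  choose next hle hnext using hstep
  obtain ⟨task, htask⟩ := exists_surjective_nat (Task β)
  let p : ℕ → FiniteSystem α ar t :=
    fun n => Nat.rec p₀ (fun m q => next (task m.unpair.1) q) n
  refine ⟨p, fun m n hmn => ?_, fun T N => ?_⟩
  · induction n, hmn using Nat.le_induction with
    | base => exact Le.refl
    | succ n _ ih => exact ih.trans hα (hle _ _)
  · obtain ⟨a, rfl⟩ := htask T
    -- The second coordinate is a dummy that makes every task recur beyond any given stage.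
    refine ⟨Nat.pair a N, Nat.right_le_pair a N, fun h => ?_⟩
    have := hnext (task a) (p (Nat.pair a N)) h
    change Solves _ (next (task (Nat.unpair (Nat.pair a N)).1) (p (Nat.pair a N)))
    rwa [Nat.unpair_pair]

/-- Start from `k` isolated points, whose rank `k` is at least `k / c`, and lower it with the empty
set kept strong; the latter says that all ranks stay nonnegative. -/
theorem nonempty [Nonempty β] (hα : ∀ E, 0 < α E ∧ α E < 1) (har : ∀ E, 2 ≤ ar E) {c : ℕ}
    (hc : c = Finset.univ.lcm fun E => (α E).den) (k : ℕ) :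
    Nonempty (FiniteSystem α ar (k / c)) := by
  have hc0 : 0 < c := hc ▸ lcm_den_pos α
  have hc1 : (1 : ℚ) ≤ c := by exact_mod_cast hc0
  have hempty : ∀ {𝓔 : Set (β × Finset ℕ)} (_ : ∀ e ∈ 𝓔, e.2.card = ar e.1), rk α 𝓔 ∅ = 0 :=
    fun h𝓔 => rk_empty fun e he => by have := h𝓔 e he; have := har e.1; omega
  have h0 : ∀ e ∈ (∅ : Set (β × Finset ℕ)), e.2.card = ar e.1 := fun e he => absurd he id
  have hcard : ∀ X : Finset ℕ, rk α (∅ : Set (β × Finset ℕ)) X = X.card := fun X => by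
    have : edgesIn (∅ : Set (β × Finset ℕ)) X = ∅ := by ext; simp
    rw [rk, this, Finset.sum_empty, sub_zero]
  have hs : Strong α (∅ : Set (β × Finset ℕ)) ∅ (Finset.range k) := fun Y _ _ => by
    rw [hempty h0, hcard]
    positivity
  have ht : (0 : ℚ) ≤ k / c := by positivity
  obtain ⟨𝓔, X, -, h𝓔, -, hX, -, hrk⟩ := exists_extension_rk_eq hα har hc (t := (k : ℚ) / c)
    ⟨k, by field_simp; simp⟩ h0 (Finset.empty_subset _) (Finset.empty_subset _) hs hs
    ((hempty h0).trans_le ht) ((hempty h0).trans_le ht) (by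
      rw [hcard, Finset.card_range]
      exact div_le_self (by positivity) hc1)
  obtain ⟨p, -⟩ := exists_of_edges h𝓔 (fun Y hY => by
    rw [← hempty h𝓔]; exact hX Y (Finset.empty_subset Y) hY) hrk
  exact ⟨p⟩

end FiniteSystem

end Existence

/-! ### The union of the chain is generic -/

section Limit

variable {L : FirstOrder.Language.{u, v}} [L.IsRelational] [Fintype (Σ n, L.Relations n)]
  {α : (Σ n, L.Relations n) → ℚ} {k : ℕ}

theorem inKFix_substructure {M : Type*} [L.Structure M] (hM : IsHypergraph L M)
    {S : L.Substructure M} {Y : Finset M} (hS : (S : Set M) = Y)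
    (h0 : ∀ Z : Finset M, 0 ≤ rk α (edges L M) Z)
    (hY : rk α (edges L M) Y = (k : ℚ) / commonDenom α) : InKFix α k S := by
  have : Finite S := (hS ▸ Y.finite_toSet : (S : Set M).Finite)
  have := Fintype.ofFinite S
  exact ⟨(inKAlpha_iff_of_embedding S.subtype).2 ⟨hM.of_embedding S.subtype, fun Z _ => h0 Z⟩,
    by rw [delta_substructure hS, hY]⟩

theorem exists_isGenericFix (hL : Nonempty (Σ n, L.Relations n))
    (har : ∀ E : Σ n, L.Relations n, 2 ≤ E.1) (hα : ∀ E, 0 < α E ∧ α E < 1) (k : ℕ) :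
    ∃ (M : Type) (_ : L.Structure M), IsGenericFix α k M := by
  classical
  have hα0 : ∀ E, 0 ≤ α E := fun E => (hα E).1.le
  obtain ⟨p₀⟩ := FiniteSystem.nonempty hα har (c := commonDenom α) rfl k
  obtain ⟨p, hp, hT⟩ := FiniteSystem.exists_chain hα0 p₀
  set 𝓔 : Set ((Σ n, L.Relations n) × Finset ℕ) := {e | ∃ n, e ∈ (p n).edges} with h𝓔def
  set Z : Set ℕ := {x | ∃ n, x ∈ (p n).verts} with hZ
  have h𝓔 : ∀ e ∈ 𝓔, e.2.card = e.1.1 := fun e ⟨n, he⟩ => (p n).card_eq e he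
  have hagree : ∀ m, AgreeOn 𝓔 (p m).edges (p m).verts := by
    intro m e he
    refine ⟨fun ⟨n, hn⟩ => ?_, fun h => ⟨m, h⟩⟩
    rcases le_total m n with hmn | hnm
    · exact ((hp m n hmn).agree e he).1 hn
    · exact ((hp n m hnm).agree e ((p n).supp e hn)).2 hn
  have hfin : ∀ (Y : Finset ℕ) (N : ℕ), (Y : Set ℕ) ⊆ Z → ∃ m, N ≤ m ∧ Y ⊆ (p m).verts := by
    intro Y N
    induction Y using Finset.induction_on with
    | empty => exact fun _ => ⟨N, le_rfl, Finset.empty_subset _⟩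
    | insert x Y hx ih =>
      intro hY
      rw [Finset.coe_insert, Set.insert_subset_iff] at hY
      obtain ⟨m, hNm, hm⟩ := ih hY.2
      obtain ⟨n, hn⟩ := hY.1
      refine ⟨max m n, hNm.trans (le_max_left _ _), Finset.insert_subset ?_ ?_⟩
      · exact (hp n _ (le_max_right m n)).subset hn
      · exact hm.trans (hp m _ (le_max_left m n)).subset
  have hstrong : ∀ m (Y : Finset ℕ), (p m).verts ⊆ Y → (Y : Set ℕ) ⊆ Z →
      rk α 𝓔 (p m).verts ≤ rk α 𝓔 Y := by
    intro m Y hmY hYZ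
    obtain ⟨n, hmn, hn⟩ := hfin Y m hYZ
    rw [rk_congr ((hagree n).mono hn), rk_congr ((hagree n).mono (hp m n hmn).subset)]
    exact (hp m n hmn).strong Y hmY hn
  have hnonneg : ∀ Y : Finset ℕ, (Y : Set ℕ) ⊆ Z → 0 ≤ rk α 𝓔 Y := by
    intro Y hYZ
    obtain ⟨n, -, hn⟩ := hfin Y 0 hYZ
    rw [rk_congr ((hagree n).mono hn)]
    exact (p n).nonneg Y hn
  have hrk : ∀ m, rk α 𝓔 (p m).verts = (k : ℚ) / commonDenom α := fun m => by
    rw [rk_congr (hagree m), (p m).rk_eq]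
  have hvZ : ∀ m, ((p m).verts : Set ℕ) ⊆ Z := fun m x hx => ⟨m, hx⟩
  let := structureOn 𝓔 Z
  have hM : IsHypergraph L Z := isHypergraph_structureOn Z
  have hemb := isEdgeEmb_structureOn h𝓔 Z
  have hmapZ : ∀ Y : Finset Z, ((Y.map (Function.Embedding.subtype (· ∈ Z)) : Finset ℕ) : Set ℕ) ⊆ Z := by
    intro Y x hx
    obtain ⟨y, -, rfl⟩ := Finset.mem_map.1 (Finset.mem_coe.1 hx)
    exact y.2
  have hnonneg' : ∀ Y : Finset Z, 0 ≤ rk α (edges L Z) Y := fun Y => by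
    rw [← hemb.rk_map]
    exact hnonneg _ (hmapZ Y)
  let X : ℕ → Finset Z := fun m => (p m).verts.subtype (· ∈ Z)
  have hX : ∀ m, (X m).map (Function.Embedding.subtype (· ∈ Z)) = (p m).verts := fun m => by
    rw [Finset.subtype_map, Finset.filter_true_of_mem fun x hx => hvZ m hx]
  have hXall : ∀ m, StrongAll α (edges L Z) (X m) := by
    intro m Y hY
    rw [← hemb.rk_map, ← hemb.rk_map, hX]
    exact hstrong m _ (hX m ▸ Finset.map_subset_map.2 hY) (hmapZ Y)
  have hXK : ∀ m, InKFix α k (substructureOf (X m : Set Z) : L.Substructure Z) := fun m =>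
    inKFix_substructure hM (coe_substructureOf _) hnonneg' (by rw [← hemb.rk_map, hX, hrk])
  have hXmono : ∀ m n, m ≤ n → X m ⊆ X n := fun m n hmn => by
    rw [← Finset.map_subset_map (f := Function.Embedding.subtype (· ∈ Z)), hX, hX]
    exact (hp m n hmn).subset
  refine ⟨Z, this, ⟨inferInstance, inKAlphaBar_iff.2 ⟨hM, hnonneg'⟩,
    ⟨fun m => substructureOf (X m : Set Z), hXK, fun m => ?_, fun z => ?_⟩, fun A hA => ?_, ?_⟩⟩
  · exact (strongSub_iff (coe_substructureOf _) (coe_substructureOf _)).2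
      ⟨hXmono m (m + 1) m.le_succ, (hXall m).strong⟩
  · obtain ⟨n, hn⟩ := z.2
    exact ⟨n, Finset.mem_coe.2 (Finset.mem_subtype.2 hn)⟩
  · obtain ⟨Y, hY⟩ := exists_finset_eq A
    obtain ⟨m, -, hm⟩ := hfin _ 0 (hmapZ Y)
    refine ⟨substructureOf (X m : Set Z), ?_, hXK m, (strongIn_iff (coe_substructureOf _)).2 (hXall m)⟩
    rw [← SetLike.coe_subset_coe, hY, coe_substructureOf, Finset.coe_subset,
      ← Finset.map_subset_map (f := Function.Embedding.subtype (· ∈ Z)), hX]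
    exact hm
  · intro A B _ _ hA hB i f hi hf
    have := hA.1.1
    have := hB.1.1
    have := Fintype.ofFinite A
    have := Fintype.ofFinite B
    rw [isStrongEmbedding_iff] at hi
    let g : A ↪ ℕ := f.toEmbedding.trans (Function.Embedding.subtype (· ∈ Z))
    have hgf : ∀ a, (f a : ℕ) = g a := fun a => rfl
    have hg𝓔 : IsEdgeEmb (edges L A) 𝓔 g := hemb.comp (isEdgeEmb f)
    have hgZ : ((Finset.univ.map g : Finset ℕ) : Set ℕ) ⊆ Z := fun x hx => by
      obtain ⟨a, -, rfl⟩ := Finset.mem_map.1 (Finset.mem_coe.1 hx)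
      exact (f a).2
    have hgs := (isStrongEmbedding_structureOn h𝓔 f hgf).1 hf
    let e := Fintype.equivFin B
    have hfinB : (mapEdges e.toEmbedding (edges L B)).Finite := Set.toFinite _
    -- A copy of `B` on an initial segment, with the embedding of `A` prescribed on the image of
    -- `A`; the value 0 elsewhere is never read.
    let T : FiniteSystem.Task (Σ n, L.Relations n) := ⟨Fintype.card B, hfinB.toFinset,
      Finset.univ.map (i.toEmbedding.trans e.toEmbedding),
      Function.extend (fun a => e (i a)) g fun _ => 0⟩
    have hext : ∀ a, Function.extend (fun a => e (i a)) g (fun _ => 0) (e (i a)) = g a := fun a =>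
      (e.injective.comp i.injective).extend_apply _ _ a
    obtain ⟨N, -, hN⟩ := hfin _ 0 hgZ
    obtain ⟨m, hNm, hm⟩ := hT T N
    have hgm : Finset.univ.map g ⊆ (p m).verts := hN.trans (hp N m hNm).subset
    have hgv : ∀ a, g a ∈ (p m).verts := fun a => hgm (Finset.mem_map_of_mem g (Finset.mem_univ a))
    have hgm𝓔 := hg𝓔.congr (hagree m) hgv
    obtain ⟨𝓕, h, W, h𝓕, hag, hB𝓕, hhi, hXW, hhW, hsX, hsH, hrkW⟩ :=
      exists_free_amalgam (α := α) (p m).card_eq hB.1.2.1.card_eq (isEdgeEmb i) hgm𝓔 hgv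
    have hXs := hsX hi
    have hHs := hsH fun Y hY hYm => by
      rw [← rk_congr ((hagree m).mono hgm), ← rk_congr ((hagree m).mono hYm)]
      exact hgs Y hY fun x hx => hvZ m (hYm hx)
    obtain ⟨q, rfl, hqag⟩ := FiniteSystem.exists_of_edges (ar := Sigma.fst)
      (t := (k : ℚ) / commonDenom α) h𝓕
      (hXs.nonneg hα0 hXW fun Y hY => by rw [rk_congr (hag.mono hY)]; exact (p m).nonneg Y hY) (by
        rw [← delta_eq_rk, ← delta_eq_rk, hA.2, hB.2, (p m).rk_eq] at hrkW
        linarith)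
    have hhv : Finset.univ.map h ⊆ q.verts := fun x hx => by
      obtain ⟨b, -, rfl⟩ := Finset.mem_map.1 hx
      exact hhW b
    -- The free amalgam of `p m` with `B` over `A` has rank `k / c` again and solves the task, so
    -- the chain solves it at stage `m + 1`.
    have hsolve : ∃ q, FiniteSystem.Le (p m) q ∧ FiniteSystem.Solves T q := by
      refine ⟨q, ⟨hXW, (hqag.mono hXW).trans hag, hXs.congr hXW hqag.symm⟩,
        e.symm.toEmbedding.trans h, ?_, ?_, fun x => hhW _, ?_⟩
      · intro E s
        have h1 := (hB𝓕.congr hqag.symm hhW) E (s.map e.symm.toEmbedding)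
        rw [Finset.map_map] at h1
        rw [h1, ← isEdgeEmb_mapEdges e.toEmbedding, Finset.map_map]
        simp [T]
      · intro x hx
        obtain ⟨a, -, rfl⟩ := Finset.mem_map.1 hx
        refine Eq.trans ?_ (hext a).symm
        simpa using hhi a
      · rw [← Finset.map_map, Finset.map_univ_equiv]
        exact hHs.congr hhv hqag.symm
    obtain ⟨h', hh', hfix, hv, hs'⟩ := hm hsolve
    let h'' : B ↪ ℕ := e.toEmbedding.trans h'
    have hB𝓔 : IsEdgeEmb (edges L B) 𝓔 h'' := by
      refine IsEdgeEmb.comp (hh'.congr (hagree (m + 1)).symm hv) ?_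
      have := isEdgeEmb_mapEdges e.toEmbedding (edges L B)
      rwa [← hfinB.coe_toFinset] at this
    obtain ⟨G, hG⟩ := exists_embedding_structureOn hB.1.2.1 h𝓔 hB𝓔 (Z := Z)
      fun b => hvZ (m + 1) (hv (e b))
    have hh''v : Finset.univ.map h'' ⊆ (p (m + 1)).verts := fun x hx => by
      obtain ⟨b, -, rfl⟩ := Finset.mem_map.1 hx
      exact hv (e b)
    refine ⟨G, (isStrongEmbedding_structureOn h𝓔 G hG).2 fun Y hY hYZ => ?_, ?_⟩
    -- Any finite `Y` lies in a later stage, in which stage `m + 1` is strong; transitivity gives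
    -- strength of the copy of `B` in the union.
    · obtain ⟨n, hmn, hn⟩ := hfin Y (m + 1) hYZ
      have h1 : Strong α (p (m + 1)).edges (Finset.univ.map h'') (p (m + 1)).verts := by
        rw [← Finset.map_map, Finset.map_univ_equiv]
        exact hs'
      have h2 := hp (m + 1) n hmn
      rw [rk_congr ((hagree n).mono (hh''v.trans h2.subset)), rk_congr ((hagree n).mono hn)]
      exact (h1.congr hh''v h2.agree.symm).trans hα0 hh''v h2.subset h2.strong Y hY hn
    · ext a
      change (G (i a) : ℕ) = f a
      rw [hG]
      refine (hfix (e (i a)) ?_).trans (hext a)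
      exact Finset.mem_map_of_mem (i.toEmbedding.trans e.toEmbedding) (Finset.mem_univ a)

end Limit

end BaldwinShi

theorem theorem4p3 {L : FirstOrder.Language.{u, v}} [L.IsRelational] [Fintype (Σ n, L.Relations n)]
    (hL : Nonempty (Σ n, L.Relations n)) (har : ∀ E : Σ n, L.Relations n, 2 ≤ E.1)
    (α : (Σ n, L.Relations n) → ℚ) (hα : ∀ E, 0 < α E ∧ α E < 1) (k : ℕ) :
    BaldwinShi.IsFraisseClassFix α k ∧
    (∃ (M : Type) (_ : L.Structure M), BaldwinShi.IsGenericFix α k M) ∧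
    (∀ (M : Type w) (N : Type w') [L.Structure M] [L.Structure N],
      BaldwinShi.IsGenericFix α k M → BaldwinShi.IsGenericFix α k N → Nonempty (M ≃[L] N)) ∧
    ∀ (M : Type w) [L.Structure M], BaldwinShi.IsGenericFix α k M →
      M ⊨ BaldwinShi.theoryS α ∧
      BaldwinShi.dim α M =
        (((k : ℚ) / (BaldwinShi.commonDenom α : ℚ) : ℚ) : WithTop ℚ) := by
  refine ⟨⟨?_, ?_⟩, ?_, ?_, ?_⟩
  · exact BaldwinShi.jointEmbedding hL har hα k
  · exact BaldwinShi.amalgamation hα k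
  · exact BaldwinShi.exists_isGenericFix hL har hα k
  · intro M N _ _ hM hN
    exact hM.nonempty_equiv hL har hα hN
  · intro M _ hM
    exact ⟨hM.models_theoryS hL har hα, hM.dim_eq har⟩
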